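/- Let $\mathcal H$ be a complex Hilbert space, $T\in\mathcal B(\mathcal H)$ self-adjoint, and let $\mathcal T_1$ be the set of all pairs $(P,Q)$ of orthogonal projections on $\mathcal H$ with $T=P+Q$, with the topology given by the operator norm on $\mathcal B(\mathcal H)\times\mathcal B(\mathcal H)$. Write $\mathcal N$ and $\mathcal R$ for null space and range, decompose $$\mathcal H=\mathcal N(T)\oplus\mathcal N(T-I)\oplus\mathcal N(T-2I)\oplus\mathcal H_0,$$ where $\mathcal H_0$ is the orthogonal complement of the first three summands, and let $T_0=T|_{\mathcal H_0}$. For operators, $A<B$ means that $B-A$ is positive and injective. Suppose there are a Hilbert space $\mathcal K$, an operator $B$ on $\mathcal K$ with $0<B<I$ and a unitary $\mathcal K\oplus\mathcal K\to\mathcal H_0$ that carries $B\oplus(-B)$ to $T_0-I$; identify $\mathcal H_0$ with $\mathcal K\oplus\mathcal K$ by this unitary. For a unitary $U$ on $\mathcal K$ commuting with $B$ and an orthogonal projection $E$ on $\mathcal N(T-I)$ put $$P_{E,U}=0\oplus E\oplus I\oplus\tfrac12\begin{pmatrix}I+B&(I-B^2)^{1/2}U\\U^*(I-B^2)^{1/2}&I-B\end{pmatrix},$$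 $$Q_{E,U}=0\oplus(I-E)\oplus I\oplus\tfrac12\begin{pmatrix}I+B&-(I-B^2)^{1/2}U\\-U^*(I-B^2)^{1/2}&I-B\end{pmatrix}.$$ In the sets below, $U$ ranges over the unitaries commuting with $B$ and $E$ over the orthogonal projections on $\mathcal N(T-I)$. (i) The connected components of $\mathcal T_1$ are exactly the sets $\{(P_{E',U},Q_{E',U}): E'\text{ unitarily equivalent to }E\}$, where $E$ is an orthogonal projection on $\mathcal N(T-I)$; two projections give the same set if and only if they are unitarily equivalent. (ii) If $\dim\mathcal N(T-I)<\infty$, the connected components of $\mathcal T_1$ are exactly the sets $$\mathrm E_k=\{(P_{E,U},Q_{E,U}):\dim\mathcal R(E)=k\},\qquad 0\le k\le\dim\mathcal N(T-I),$$ and these are pairwise distinct. (iii) If $\dim\mathcal N(T-I)=\infty$, put, for integers $m,n\ge0$, $$\mathrm E_m=\{(P_{E,U},Q_{E,U}):\dim\mathcal R(E)=m\},\quad (\mathrm{I-E})_n=\{(P_{E,U},Q_{E,U}):\dim\mathcal R(I-E)=n\},$$ $$\mathrm E_\infty=\{(P_{E,U},Q_{E,U}):\dim\mathcal R(E)=\dim\mathcal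 R(I-E)=\infty\}.$$ The connected components of $\mathcal T_1$ are exactly the sets $\mathrm E_m$ and $(\mathrm{I-E})_n$ ($m,n\ge0$), which are pairwise distinct and disjoint from $\mathrm E_\infty$, together with the sets in (i) for those $E$ with $\dim\mathcal R(E)=\dim\mathcal R(I-E)=\infty$. If $\mathcal N(T-I)$ is separable, the latter are the single set $\mathrm E_\infty$, so that the components are exactly the sets $\mathrm E_m$, $(\mathrm{I-E})_n$ and $\mathrm E_\infty$. -/

import Mathlib

open scoped InnerProductSpace

noncomputable section

namespace PencilPairs

/-- The dimension of a subspace with values in `ℕ ∪ {∞}`: all infinite dimensions are `⊤`.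
(The algebraic dimension and the Hilbert dimension are finite at the same time, and then equal.) -/
def hdim {V : Type*} [AddCommGroup V] [Module ℂ V] (M : Submodule ℂ V) : ℕ∞ :=
  Cardinal.toENat (Module.rank ℂ M)

/-- `A < B` for bounded operators: `B - A` is positive and injective. -/
def StrictLess {K : Type*} [NormedAddCommGroup K] [InnerProductSpace ℂ K]
    (A B : K →L[ℂ] K) : Prop :=
  (B - A).IsPositive ∧ Function.Injective (B - A)

section NullSpaces

variable {H : Type*} [NormedAddCommGroup H] [InnerProductSpace ℂ H]

/-- `N(T - μ I)`. -/
def nullSpace (T : H →L[ℂ] H) (μ : ℂ) : Submodule ℂ H :=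
  (T - μ • ContinuousLinearMap.id ℂ H).ker

theorem mem_nullSpace {T : H →L[ℂ] H} {μ : ℂ} {x : H} : x ∈ nullSpace T μ ↔ T x = μ • x := by
  simp [nullSpace, sub_eq_zero]

variable [CompleteSpace H]

instance instCompleteNullSpace (T : H →L[ℂ] H) (μ : ℂ) : CompleteSpace (nullSpace T μ) := by
  unfold nullSpace
  infer_instance

/-- The subspace `H₀` of the generic part with respect to `1`: the orthogonal complement of
`N(T) + N(T - I) + N(T - 2I)`. -/
def genericSpace (T : H →L[ℂ] H) : Submodule ℂ H :=
  (nullSpace T 0 ⊔ nullSpace T 1 ⊔ nullSpace T 2)ᗮ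

instance instCompleteGenericSpace (T : H →L[ℂ] H) : CompleteSpace (genericSpace T) := by
  unfold genericSpace
  infer_instance

/-- For an operator `A` on a closed subspace `M` of `H`, the operator `A ⊕ 0` on `M ⊕ Mᗮ = H`. -/
def extendZero (M : Submodule ℂ H) [CompleteSpace M] (A : M →L[ℂ] M) : H →L[ℂ] H :=
  M.subtypeL ∘L A ∘L M.orthogonalProjectionOnto

/-- The generic part `T₀ = T|_{H₀}` of `T` with respect to `1`, as an operator on `H₀`.
The projection back to `H₀` only adjusts the codomain: see `coe_genericPart`. -/
def genericPart (T : H →L[ℂ] H) : genericSpace T →L[ℂ] genericSpace T :=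
  (genericSpace T).orthogonalProjectionOnto ∘L T ∘L (genericSpace T).subtypeL

theorem apply_mem_genericSpace {T : H →L[ℂ] H} (hT : IsSelfAdjoint T) {x : H}
    (hx : x ∈ genericSpace T) : T x ∈ genericSpace T := by
  have key : ∀ y ∈ nullSpace T 0 ⊔ nullSpace T 1 ⊔ nullSpace T 2,
      T y ∈ nullSpace T 0 ⊔ nullSpace T 1 ⊔ nullSpace T 2 := by
    intro y hy
    obtain ⟨u, hu, c, hc, rfl⟩ := Submodule.mem_sup.1 hy
    obtain ⟨a, ha, b, hb, rfl⟩ := Submodule.mem_sup.1 hu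
    rw [map_add, map_add, mem_nullSpace.1 ha, mem_nullSpace.1 hb, mem_nullSpace.1 hc]
    exact Submodule.add_mem_sup (Submodule.add_mem_sup (Submodule.smul_mem _ _ ha)
      (Submodule.smul_mem _ _ hb)) (Submodule.smul_mem _ _ hc)
  intro y hy
  have h := hT.isSymmetric y x
  simp only [ContinuousLinearMap.coe_coe] at h
  rw [← h]
  exact hx _ (key y hy)

theorem coe_genericPart {T : H →L[ℂ] H} (hT : IsSelfAdjoint T) (x : genericSpace T) :
    (genericPart T x : H) = T x := by
  exact Submodule.starProjection_eq_self_iff.2 (apply_mem_genericSpace hT x.2)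

/-- `𝒯₁`: all pairs `(P, Q)` of orthogonal projections on `H` with `T = P + Q`. -/
def pairs (T : H →L[ℂ] H) : Set ((H →L[ℂ] H) × (H →L[ℂ] H)) :=
  {p | IsStarProjection p.1 ∧ IsStarProjection p.2 ∧ T = p.1 + p.2}

/-- Unitary equivalence of bounded operators on one Hilbert space. -/
def UnitarilyEquiv (A B : H →L[ℂ] H) : Prop :=
  ∃ V ∈ unitary (H →L[ℂ] H), B = V * A * star V

end NullSpaces

/-- The set of connected components of `S`, with the subspace topology. -/
def components {X : Type*} [TopologicalSpace X] (S : Set X) : Set (Set X) :=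
  {C | ∃ x ∈ S, C = connectedComponentIn S x}

section Blocks

variable {K : Type*} [NormedAddCommGroup K] [InnerProductSpace ℂ K]

/-- The operator on the Hilbert space `K ⊕ K` with the given `2 × 2` operator matrix. -/
def block (A₁₁ A₁₂ A₂₁ A₂₂ : K →L[ℂ] K) : WithLp 2 (K × K) →L[ℂ] WithLp 2 (K × K) :=
  (WithLp.prodContinuousLinearEquiv 2 ℂ K K).symm.toContinuousLinearMap ∘L
    ((A₁₁ ∘L ContinuousLinearMap.fst ℂ K K + A₁₂ ∘L ContinuousLinearMap.snd ℂ K K).prod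
      (A₂₁ ∘L ContinuousLinearMap.fst ℂ K K + A₂₂ ∘L ContinuousLinearMap.snd ℂ K K)) ∘L
    (WithLp.prodContinuousLinearEquiv 2 ℂ K K).toContinuousLinearMap

theorem block_apply (A₁₁ A₁₂ A₂₁ A₂₂ : K →L[ℂ] K) (x y : K) :
    block A₁₁ A₁₂ A₂₁ A₂₂ (WithLp.toLp 2 (x, y)) =
      WithLp.toLp 2 (A₁₁ x + A₁₂ y, A₂₁ x + A₂₂ y) := rfl

variable [CompleteSpace K]

/-- `(I - B²)^{1/2}`. -/
def offDiag (B : K →L[ℂ] K) : K →L[ℂ] K :=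
  CFC.sqrt (1 - B * B)

/-- `P_U = ½ [[I + B, (I - B²)^{1/2} U], [U* (I - B²)^{1/2}, I - B]]`. -/
def blockP (B U : K →L[ℂ] K) : WithLp 2 (K × K) →L[ℂ] WithLp 2 (K × K) :=
  (1 / 2 : ℂ) • block (1 + B) (offDiag B * U) (star U * offDiag B) (1 - B)

/-- `Q_U = ½ [[I + B, -(I - B²)^{1/2} U], [-U* (I - B²)^{1/2}, I - B]]`. -/
def blockQ (B U : K →L[ℂ] K) : WithLp 2 (K × K) →L[ℂ] WithLp 2 (K × K) :=
  (1 / 2 : ℂ) • block (1 + B) (-(offDiag B * U)) (-(star U * offDiag B)) (1 - B)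

end Blocks

section Representation

variable {H : Type*} [NormedAddCommGroup H] [InnerProductSpace ℂ H] [CompleteSpace H]
  {K : Type*} [NormedAddCommGroup K] [InnerProductSpace ℂ K]

/-- The operator on `H₀` that corresponds to `A` on `K ⊕ K` under the unitary `W`. -/
def transport {T : H →L[ℂ] H} (W : WithLp 2 (K × K) ≃ₗᵢ[ℂ] genericSpace T)
    (A : WithLp 2 (K × K) →L[ℂ] WithLp 2 (K × K)) : genericSpace T →L[ℂ] genericSpace T :=
  W.toContinuousLinearEquiv.toContinuousLinearMap ∘L A ∘L
    W.symm.toContinuousLinearEquiv.toContinuousLinearMap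

variable [CompleteSpace K]

/-- `P_{1,U} = 0 ⊕ E ⊕ I ⊕ P_U` on `H = N(T) ⊕ N(T - I) ⊕ N(T - 2I) ⊕ H₀`, where `H₀` is
identified with `K ⊕ K` by `W`. -/
def repP {T : H →L[ℂ] H} (W : WithLp 2 (K × K) ≃ₗᵢ[ℂ] genericSpace T) (B : K →L[ℂ] K)
    (E : nullSpace T 1 →L[ℂ] nullSpace T 1) (U : K →L[ℂ] K) : H →L[ℂ] H :=
  extendZero (nullSpace T 1) E + extendZero (nullSpace T 2) 1 +
    extendZero (genericSpace T) (transport W (blockP B U))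

/-- `Q_{1,U} = 0 ⊕ (I - E) ⊕ I ⊕ Q_U`. -/
def repQ {T : H →L[ℂ] H} (W : WithLp 2 (K × K) ≃ₗᵢ[ℂ] genericSpace T) (B : K →L[ℂ] K)
    (E : nullSpace T 1 →L[ℂ] nullSpace T 1) (U : K →L[ℂ] K) : H →L[ℂ] H :=
  extendZero (nullSpace T 1) (1 - E) + extendZero (nullSpace T 2) 1 +
    extendZero (genericSpace T) (transport W (blockQ B U))

/-- All `(P_{1,U}, Q_{1,U})` with `U` a unitary in `{B}'` and `E` a projection on `N(T - I)` that
satisfies `p`. -/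
def repPairs {T : H →L[ℂ] H} (W : WithLp 2 (K × K) ≃ₗᵢ[ℂ] genericSpace T) (B : K →L[ℂ] K)
    (p : (nullSpace T 1 →L[ℂ] nullSpace T 1) → Prop) : Set ((H →L[ℂ] H) × (H →L[ℂ] H)) :=
  {x | ∃ (E : nullSpace T 1 →L[ℂ] nullSpace T 1) (U : K →L[ℂ] K),
    IsStarProjection E ∧ p E ∧ U ∈ unitary (K →L[ℂ] K) ∧ Commute U B ∧
      x = (repP W B E U, repQ W B E U)}

/-- The pairs for which the projection on `N(T - I)` is unitarily equivalent to `E`. -/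
def classOf {T : H →L[ℂ] H} (W : WithLp 2 (K × K) ≃ₗᵢ[ℂ] genericSpace T) (B : K →L[ℂ] K)
    (E : nullSpace T 1 →L[ℂ] nullSpace T 1) : Set ((H →L[ℂ] H) × (H →L[ℂ] H)) :=
  repPairs W B (fun E' => UnitarilyEquiv E E')

/-- `E_k`: the pairs with `dim R(E) = k`. -/
def rankClass {T : H →L[ℂ] H} (W : WithLp 2 (K × K) ≃ₗᵢ[ℂ] genericSpace T) (B : K →L[ℂ] K)
    (k : ℕ) : Set ((H →L[ℂ] H) × (H →L[ℂ] H)) :=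
  repPairs W B (fun E => hdim E.range = k)

/-- `(I - E)_n`: the pairs with `dim R(I - E) = n`. -/
def corankClass {T : H →L[ℂ] H} (W : WithLp 2 (K × K) ≃ₗᵢ[ℂ] genericSpace T) (B : K →L[ℂ] K)
    (n : ℕ) : Set ((H →L[ℂ] H) × (H →L[ℂ] H)) :=
  repPairs W B (fun E => hdim (1 - E).range = n)

/-- `E_∞`: the pairs with `dim R(E) = dim R(I - E) = ∞`. -/
def infiniteClass {T : H →L[ℂ] H} (W : WithLp 2 (K × K) ≃ₗᵢ[ℂ] genericSpace T)
    (B : K →L[ℂ] K) : Set ((H →L[ℂ] H) × (H →L[ℂ] H)) :=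
  repPairs W B (fun E => hdim E.range = ⊤ ∧ hdim (1 - E).range = ⊤)

end Representation

end PencilPairs

end

/-! Every pair is forced on each summand of the decomposition. On `N(T)` both projections vanish, on
`N(T - 2I)` both are the identity, and on `N(T - I)` they are complementary, so only a projection
`E` is free. On the generic part put `A = p + q - 1 = B ⊕ (-B)` and `J = p - q`. Then `J`
anticommutes with `A` and `J² = 1 - A²`. As `B` is positive and injective, anticommutation kills the
diagonal blocks of `J` and makes the off-diagonal block commute with `B`. Its polar decomposition
has modulus `(1 - B²)^{1/2}` and a unitary factor `U` in the commutant of `B`. Hence `pairs T` is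
parametrized by `E` and `U` (`pairs_eq_repPairs`).

The parameter `U` contributes no components, because the unitaries commuting with `B` form a
norm-connected set (`isPreconnected_unitary_commutant`). With `B = 1` the same result shows that the
unitary orbit of `E` is connected, so every `classOf` is connected.

Conversely, compression to `N(T - I)` recovers `E` continuously from the pair, and projections at
distance less than `1` are unitarily equivalent (`exists_unitary_conj_of_norm_sub_lt_one`). The
unitary class of `E` is therefore locally constant on `pairs T`, and distinct classes are separated.

The rest is the classification of projections up to unitary equivalence: finite rank, or finite
corank, is a complete invariant, and in the separable case all projections with both dimensions
infinite are equivalent. -/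

open scoped InnerProductSpace

noncomputable section

namespace PencilPairs

/-! ### Signs of self-adjoint operators inside the bicommutant -/

section Commutant

variable {K : Type*} [NormedAddCommGroup K] [InnerProductSpace ℂ K] [CompleteSpace K]

/-- `B` preserves the kernel of `A` because it commutes with `A`, and preserves its orthogonal
complement because it is self-adjoint. -/
theorem isSelfAdjoint_commute_starProjection_ker {A B : K →L[ℂ] K} (hB : IsSelfAdjoint B)
    (hAB : Commute A B) : Commute (A.ker.starProjection) B := by
  have hinv : ∀ x, A x = 0 → A (B x) = 0 := fun x hx => by
    have := DFunLike.congr_fun hAB.eq x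
    simp only [mul_apply_eq_comp] at this
    rw [this, hx, map_zero]
  ext x
  simp only [mul_apply_eq_comp]
  have hx : x = A.ker.starProjection x + (x - A.ker.starProjection x) := by abel
  have h1 : B (A.ker.starProjection x) ∈ A.ker :=
    hinv _ (Submodule.starProjection_apply_mem A.ker x)
  have h2 : B (x - A.ker.starProjection x) ∈ A.kerᗮ := by
    intro y hy
    have := hB.isSymmetric y (x - A.ker.starProjection x)
    simp only [ContinuousLinearMap.coe_coe] at this
    rw [← this]
    exact Submodule.sub_starProjection_mem_orthogonal x _ (hinv _ hy)
  conv_lhs => rw [hx, map_add, map_add, Submodule.starProjection_eq_self_iff.2 h1,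
    (Submodule.starProjection_apply_eq_zero_iff (K := A.ker)).2 h2, add_zero]

/-- The projection onto the kernel of `Y⁻` plays the role of the spectral projection of `[0, ∞)`,
which continuous functional calculus does not provide. The symmetry `2Q - 1` is then a sign of `Y`,
with `(2Q - 1)Y = Y⁺ + Y⁻`. -/
theorem exists_starProjection_mul_nonneg {Y : K →L[ℂ] K} (hY : IsSelfAdjoint Y) :
    ∃ Q : K →L[ℂ] K, IsStarProjection Q ∧ Commute Q Y ∧ 0 ≤ (2 * Q - 1) * Y ∧
      ∀ B : K →L[ℂ] K, IsSelfAdjoint B → Commute Y B → Commute Q B := by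
  have hcomm : ∀ B : K →L[ℂ] K, Commute Y B → Commute (Y⁻) B := fun B h => by
    rw [CFC.negPart_def]; exact h.cfcₙ_real _
  set Q := (Y⁻).ker.starProjection with hQ
  have key : ∀ B : K →L[ℂ] K, IsSelfAdjoint B → Commute Y B → Commute Q B := fun B hB h =>
    isSelfAdjoint_commute_starProjection_ker hB (hcomm B h)
  have hQY := key Y hY (Commute.refl _)
  have h1 : Q * Y⁺ = Y⁺ := by
    ext x
    refine Submodule.starProjection_eq_self_iff.2 ?_
    exact DFunLike.congr_fun (CFC.negPart_mul_posPart Y) x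
  have h2 : Y⁻ * Q = 0 := by
    ext x
    exact Submodule.starProjection_apply_mem (Y⁻).ker x
  have hQs : IsStarProjection Q := isStarProjection_starProjection
  have h3 : Q * Y⁻ = 0 := by
    have := congrArg star h2
    simpa [hQs.2.star_eq, (CFC.negPart_nonneg Y).isSelfAdjoint.star_eq] using this
  refine ⟨Q, hQs, hQY, ?_, key⟩
  have : (2 * Q - 1) * Y = Y⁺ + Y⁻ := by
    conv_lhs => rw [← CFC.posPart_sub_negPart Y hY]
    calc (2 * Q - 1) * (Y⁺ - Y⁻) = 2 * (Q * Y⁺) - 2 * (Q * Y⁻) - Y⁺ + Y⁻ := by noncomm_ring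
      _ = Y⁺ + Y⁻ := by rw [h1, h3]; noncomm_ring
  rw [this]
  exact add_nonneg (CFC.posPart_nonneg Y) (CFC.negPart_nonneg Y)

end Commutant

/-! ### Unitaries and projections in C⋆-algebras -/

section CStar

variable {A : Type*} [CStarAlgebra A]

theorem smul_add_smul_one_sub_mem_unitary {Q : A} (hQ : IsStarProjection Q) {z : ℂ}
    (hz : star z * z = 1) : z • Q + star z • (1 - Q) ∈ unitary A := by
  have hz' : z * star z = 1 := by rw [mul_comm]; exact hz
  have hs : star (z • Q + star z • (1 - Q)) = star z • Q + z • (1 - Q) := by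
    simp [hQ.2.star_eq]
  have hQQ : Q * Q = Q := hQ.1
  rw [Unitary.mem_iff, hs]
  constructor
  · simp only [add_mul, mul_add, smul_mul_smul_comm, hQ.mul_one_sub_self, hQ.one_sub_mul_self,
      smul_zero, hQQ, hQ.one_sub.1.eq, hz, hz']
    simp
  · simp only [add_mul, mul_add, smul_mul_smul_comm, hQ.mul_one_sub_self, hQ.one_sub_mul_self,
      smul_zero, hQQ, hQ.one_sub.1.eq, hz, hz']
    simp

/-- Since `(W - 1)*(W - 1) = 2 - (W + W*) ≤ 2`, the distance is in fact at most `√2`. -/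
theorem norm_sub_one_lt_two_of_nonneg [PartialOrder A] [StarOrderedRing A] {W : A}
    (hW : W ∈ unitary A) (h : 0 ≤ W + star W) : ‖W - 1‖ < 2 := by
  have h1 : star (W - 1) * (W - 1) = 2 - (W + star W) := by
    have := (Unitary.mem_iff.1 hW).1
    simp only [star_sub, star_one, sub_mul, mul_sub, this, mul_one, one_mul]
    rw [← one_add_one_eq_two]; abel
  have h2 : ‖star (W - 1) * (W - 1)‖ ≤ ‖(2 : A)‖ :=
    CStarAlgebra.norm_le_norm_of_nonneg_of_le (star_mul_self_nonneg _)
      (by rw [h1]; exact sub_le_self _ h)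
  rw [CStarRing.norm_star_mul_self] at h2
  have h3 : ‖(2 : A)‖ ≤ 2 := by
    rcases subsingleton_or_nontrivial A with h | h
    · rw [Subsingleton.elim (2 : A) 0]; simp
    · rw [← one_add_one_eq_two]
      refine (norm_add_le _ _).trans ?_
      rw [CStarRing.norm_one]; norm_num
  nlinarith [norm_nonneg (W - 1)]

/-- The adjoint of a unitary is its inverse, so no Fuglede-type argument is needed. -/
theorem commute_star_of_mem_unitary {U B : A} (hU : U ∈ unitary A) (h : Commute U B) :
    Commute (star U) B := by
  have h1 := (Unitary.mem_iff.1 hU).1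
  have h2 := (Unitary.mem_iff.1 hU).2
  calc star U * B = star U * (B * U) * star U := by simp only [mul_assoc, h2, mul_one]
    _ = star U * U * B * star U := by rw [← h.eq]; simp only [mul_assoc]
    _ = B * star U := by rw [h1, one_mul]

/-- A unitary at distance less than `2` from `1` is joined to `1` inside its bicommutant. -/
theorem exists_continuous_unitary_commute {W : A} (hW : W ∈ unitary A) (h : ‖W - 1‖ < 2) :
    ∃ p : ℝ → A, Continuous p ∧ p 0 = 1 ∧ p 1 = W ∧ (∀ t, p t ∈ unitary A) ∧
      ∀ B, Commute W B → ∀ t, Commute (p t) B := by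
  -- The path is `exp(i t arg W)`. The norm bound keeps `-1`, where `arg` jumps, out of the
  -- spectrum, so the endpoint is `W`.
  refine ⟨fun t => (selfAdjoint.expUnitary (t • Unitary.argSelfAdjoint ⟨W, hW⟩) : A),
    ?_, by simp, ?_, fun t => Subtype.prop _, fun B hB t => ?_⟩
  · exact continuous_subtype_val.comp (selfAdjoint.continuous_expUnitary.comp (by fun_prop))
  · simp only [one_smul]
    rw [expUnitary_argSelfAdjoint (u := ⟨W, hW⟩) h]
  · simp only
    rw [selfAdjoint.expUnitary_coe]
    refine Commute.exp_left (Commute.smul_left ?_ _)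
    rw [selfAdjoint.val_smul]
    refine Commute.smul_left ?_ _
    rw [Unitary.argSelfAdjoint_coe]
    -- `arg W` is a function of the normal element `W`, so it commutes with whatever commutes with
    -- `W` and `W*`.
    exact hB.cfc (commute_star_of_mem_unitary hW hB) _

/-- Two projections at distance less than `1` are unitarily equivalent. -/
theorem exists_unitary_conj_of_norm_sub_lt_one [PartialOrder A] [StarOrderedRing A]
    {E F : A} (hE : IsStarProjection E) (hF : IsStarProjection F) (h : ‖E - F‖ < 1) :
    ∃ V ∈ unitary A, F = V * E * star V := by
  have hEE : E * E = E := hE.1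
  have hFF : F * F = F := hF.1
  set e := 2 * E - 1 with he
  set f := 2 * F - 1 with hf
  have hee : e * e = 1 := by
    calc e * e = 4 * (E * E) - 4 * E + 1 := by rw [he]; noncomm_ring
      _ = 1 := by rw [hEE]; noncomm_ring
  have hff : f * f = 1 := by
    calc f * f = 4 * (F * F) - 4 * F + 1 := by rw [hf]; noncomm_ring
      _ = 1 := by rw [hFF]; noncomm_ring
  have hes : star e = e := by
    rw [he, star_sub, star_mul, hE.2.star_eq, star_one, star_ofNat, mul_two, two_mul]
  have hfs : star f = f := by
    rw [hf, star_sub, star_mul, hF.2.star_eq, star_one, star_ofNat, mul_two, two_mul]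
  -- For the symmetries `e = 2E - 1` and `f = 2F - 1`, this `z` satisfies `z e = f z`. Its unitary
  -- polar factor `z (z*z)^{-1/2}` still intertwines them and conjugates `E` to `F`.
  set z := 1 + f * e with hz
  have hzs : star z = 1 + e * f := by simp [hz, hes, hfs]
  have hze : z * e = f * z := by
    rw [hz, add_mul, mul_add, mul_assoc, hee, ← mul_assoc, hff]; simp [add_comm]
  have hzf : e * star z = star z * f := by
    rw [hzs, add_mul, mul_add, mul_assoc, hff, ← mul_assoc, hee]; simp [add_comm]
  set a := star z * z with ha
  have hae : Commute a e := by
    change star z * z * e = e * (star z * z)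
    rw [mul_assoc, hze, ← mul_assoc, ← hzf, mul_assoc]
  have haz : a = z * star z := by
    rw [ha, hzs, hz]
    have h1 : e * f * (f * e) = 1 := by
      rw [mul_assoc, ← mul_assoc f f, hff, one_mul, hee]
    have h2 : f * e * (e * f) = 1 := by
      rw [mul_assoc, ← mul_assoc e e, hee, one_mul, hff]
    simp only [add_mul, mul_add, h1, h2, one_mul, mul_one]; abel
  have hnorm : ‖f - e‖ < 2 := by
    have : f - e = (2 : ℝ) • (F - E) := by
      rw [hf, he, two_smul]; noncomm_ring
    rw [this, norm_smul, norm_sub_rev]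
    simp only [Real.norm_ofNat]; linarith
  -- `1 - z/2 = (e - f)e/2` has norm `‖E - F‖ < 1`, so a Neumann series inverts `z/2`.
  have hzu : IsUnit z := by
    have h1 : ‖1 - (2⁻¹ : ℝ) • z‖ < 1 := by
      have h2 : 1 - (2⁻¹ : ℝ) • z = (2⁻¹ : ℝ) • ((e - f) * e) := by
        have : (1 : A) = (2⁻¹ : ℝ) • (1 + 1) := by
          rw [← two_smul ℝ (1 : A), smul_smul]; norm_num
        conv_lhs => rw [this]
        rw [← smul_sub, sub_mul, hee, hz]
        congr 1; abel
      rw [h2, norm_smul]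
      have h3 : ‖(e - f) * e‖ = ‖e - f‖ := by
        have he' : e ∈ unitary A := by rw [Unitary.mem_iff, hes]; exact ⟨hee, hee⟩
        exact CStarRing.norm_mul_mem_unitary _ he'
      rw [h3, norm_sub_rev]; norm_num; linarith
    have h2 : IsUnit ((2⁻¹ : ℝ) • z) := by
      have := (Units.oneSub _ h1).isUnit
      simpa using this
    have h3 : z = (algebraMap ℝ A 2) * ((2⁻¹ : ℝ) • z) := by
      rw [← Algebra.smul_def, smul_smul]; norm_num
    rw [h3]
    exact ((IsUnit.mk0 (2 : ℝ) (by norm_num)).map (algebraMap ℝ A)).mul h2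
  have hau : IsUnit a := (hzu.star).mul hzu
  have ha0 : 0 ≤ a := star_mul_self_nonneg z
  set m := a ^ (-(1 / 2) : ℝ) with hm
  have hms : star m = m := (CFC.rpow_nonneg : (0 : A) ≤ a ^ (-(1 / 2) : ℝ)).isSelfAdjoint.star_eq
  have hmm : m * m * a = 1 := by
    rw [hm, ← CFC.rpow_add hau]
    nth_rewrite 2 [← CFC.rpow_one a ha0]
    rw [← CFC.rpow_add hau]
    norm_num [CFC.rpow_zero a ha0]
  have hmc : ∀ x, Commute a x → Commute m x := fun x hx => by
    rw [hm, CFC.rpow_def]; exact hx.cfc_nnreal _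
  have hme := hmc e hae
  have hma := hmc a (Commute.refl a)
  have hmz : Commute m z := hmc z (by change a * z = z * a; nth_rewrite 1 [haz]; rw [ha, mul_assoc])
  have hU : z * m ∈ unitary A := by
    rw [Unitary.mem_iff, star_mul, hms]
    constructor
    · calc m * star z * (z * m) = m * (a * m) := by rw [ha]; simp only [mul_assoc]
        _ = 1 := by rw [← hma.eq, ← mul_assoc, hmm]
    · calc z * m * (m * star z) = m * (m * (z * star z)) := by
            rw [← hmz.eq]; simp only [mul_assoc]; rw [← mul_assoc z m, ← hmz.eq, mul_assoc]
        _ = 1 := by rw [← haz, ← mul_assoc, hmm]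
  refine ⟨z * m, hU, ?_⟩
  have hconj : f * (z * m) = z * m * e := by
    rw [← mul_assoc, ← hze, mul_assoc, mul_assoc, hme.eq]
  have hconj' : F * (z * m) = z * m * E := by
    have h2 : (2 : ℝ) • (F * (z * m)) = (2 : ℝ) • (z * m * E) := by
      have : 2 * (F * (z * m)) = 2 * (z * m * E) := by
        have h3 : f * (z * m) + z * m = z * m * e + z * m := by rw [hconj]
        rw [hf, he] at h3
        calc 2 * (F * (z * m)) = (2 * F - 1) * (z * m) + z * m := by noncomm_ring
          _ = _ := h3
          _ = 2 * (z * m * E) := by noncomm_ring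
      rw [two_mul, two_mul] at this
      rw [two_smul, two_smul, this]
    exact smul_right_injective A (two_ne_zero (α := ℝ)) h2
  rw [← hconj', mul_assoc, (Unitary.mem_iff.1 hU).2, mul_one]

end CStar

/-! ### Connectedness of the unitary commutant -/

section Connected

variable {K : Type*} [NormedAddCommGroup K] [InnerProductSpace ℂ K] [CompleteSpace K]

/-- The unitaries in the commutant of a self-adjoint operator form a connected set. -/
theorem isPreconnected_unitary_commutant {B : K →L[ℂ] K} (hB : IsSelfAdjoint B) :
    IsPreconnected {U : K →L[ℂ] K | U ∈ unitary (K →L[ℂ] K) ∧ Commute U B} := by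
  refine isPreconnected_of_forall (1 : K →L[ℂ] K) fun U ⟨hU, hUB⟩ => ?_
  have hUB' := commute_star_of_mem_unitary hU hUB
  -- `Y` is twice the imaginary part of `U`. With `S` a sign of `Y`, the unitary `iS` is joined to
  -- `1` explicitly, and `(iS)*U` has nonnegative real part, so it is joined to `1` by its
  -- logarithm. The product of the two paths leads from `1` to `U`.
  set Y : K →L[ℂ] K := (Complex.I) • (star U - U) with hYdef
  have hY : IsSelfAdjoint Y := by
    rw [isSelfAdjoint_iff, hYdef]
    simp [← smul_neg]
  have hYB : Commute Y B := (hUB'.sub_left hUB).smul_left _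
  obtain ⟨Q, hQ, hQY, hpos, hcomm⟩ := exists_starProjection_mul_nonneg hY
  have hXY : Commute Y (U + star U) := by
    have h1 := (Unitary.mem_iff.1 hU).1
    have h2 := (Unitary.mem_iff.1 hU).2
    refine Commute.smul_left ?_ _
    change (star U - U) * (U + star U) = (U + star U) * (star U - U)
    simp only [sub_mul, mul_add, add_mul, mul_sub, h1, h2]; abel
  -- `Q` is only known to commute with self-adjoint operators commuting with `Y`, so `U` is split
  -- into real and imaginary parts.
  have hQU : Commute Q U := by
    have hU2 : U = (2⁻¹ : ℂ) • ((U + star U) + Complex.I • Y) := by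
      rw [hYdef, smul_smul, Complex.I_mul_I, neg_one_smul, neg_sub]
      have : U + star U + (U - star U) = (2 : ℂ) • U := by rw [two_smul]; abel
      rw [this, smul_smul]; norm_num
    rw [hU2]
    have h1 : Commute Q (U + star U) :=
      hcomm _ (by rw [isSelfAdjoint_iff, star_add, star_star, add_comm]) hXY
    exact (h1.add_right (hQY.smul_right _)).smul_right _
  have hQB : Commute Q B := hcomm B hB hYB
  set S : K →L[ℂ] K := 2 * Q - 1 with hS
  have hSS : S * S = 1 := by
    have hQQ : Q * Q = Q := hQ.1
    calc S * S = 4 * (Q * Q) - 4 * Q + 1 := by rw [hS]; noncomm_ring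
      _ = 1 := by rw [hQQ]; noncomm_ring
  have hSc : ∀ Z, Commute Q Z → Commute S Z := fun Z h =>
    ((Commute.ofNat_left 2 Z).mul_left h).sub_left (Commute.one_left Z)
  have hSs : star S = S := by
    rw [hS, star_sub, star_mul, hQ.2.star_eq, star_one, star_ofNat, mul_two, two_mul]
  clear_value S
  -- The phase on the range of `Q` turns from `1` to `i`, and on its complement from `1` to `-i`.
  set R : ℝ → (K →L[ℂ] K) := fun t => Complex.exp (t * (Real.pi / 2 * Complex.I)) • Q +
    star (Complex.exp (t * (Real.pi / 2 * Complex.I))) • (1 - Q) with hR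
  have hRu : ∀ t, R t ∈ unitary (K →L[ℂ] K) := fun t => by
    refine smul_add_smul_one_sub_mem_unitary hQ ?_
    rw [Complex.star_def, ← Complex.exp_conj, ← Complex.exp_add]
    simp [map_ofNat]
  have hR1 : R 1 = Complex.I • S := by
    simp only [hR, Complex.ofReal_one, one_mul, Complex.exp_pi_div_two_mul_I]
    rw [hS, Complex.star_def, Complex.conj_I, neg_smul, ← sub_eq_add_neg, ← smul_sub, two_mul]
    congr 1; abel
  have hRB : ∀ t, Commute (R t) B := fun t =>
    (hQB.smul_left _).add_left (((Commute.one_left B).sub_left hQB).smul_left _)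
  have hIS : Complex.I • S ∈ unitary (K →L[ℂ] K) := hR1 ▸ hRu 1
  have hW : star (Complex.I • S) * U ∈ unitary (K →L[ℂ] K) :=
    mul_mem (Unitary.star_mem hIS) hU
  have hWB : Commute (star (Complex.I • S) * U) B := by
    refine Commute.mul_left ?_ hUB
    rw [star_smul, hSs]
    exact (hSc B hQB).smul_left _
  have hW2 : ‖star (Complex.I • S) * U - 1‖ < 2 := by
    refine norm_sub_one_lt_two_of_nonneg hW ?_
    -- Twice the real part of `(iS)*U` is `S · i(U* - U) = S Y`, because `S` commutes with `U` and
    -- `U*`.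
    convert! hpos using 1
    have h1 : star U * S = S * star U := by
      have := congrArg star (hSc U hQU).eq
      simpa [hSs] using this
    rw [star_mul, star_star, mul_smul_comm, h1, star_smul, hSs, hYdef, mul_smul_comm, mul_sub,
      Complex.star_def, Complex.conj_I, smul_sub, smul_mul_assoc, neg_smul]
    abel
  obtain ⟨p, hpc, hp0, hp1, hpu, hpB⟩ := exists_continuous_unitary_commute hW hW2
  have hRc : Continuous R := by fun_prop
  refine ⟨Set.range fun t => R t * p t, ?_, ⟨0, ?_⟩, ⟨1, ?_⟩,
    isPreconnected_range (hRc.mul hpc)⟩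
  · rintro _ ⟨t, rfl⟩
    exact ⟨mul_mem (hRu t) (hpu t), (hRB t).mul_left (hpB B hWB t)⟩
  · simp [hR, hp0]
  · simp only
    rw [hp1, hR1, ← mul_assoc, (Unitary.mem_iff.1 hIS).2, one_mul]

end Connected

/-! ### Algebra of `2 × 2` operator matrices -/

section BlockAlgebra

variable {K : Type*} [NormedAddCommGroup K] [InnerProductSpace ℂ K]

theorem block_mul (a b c d a' b' c' d' : K →L[ℂ] K) :
    block a b c d * block a' b' c' d' =
      block (a * a' + b * c') (a * b' + b * d') (c * a' + d * c') (c * b' + d * d') := by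
  ext x : 1
  obtain ⟨x, y⟩ := x
  simp only [mul_apply_eq_comp, block_apply, add_apply, map_add]
  congr 2 <;> abel

theorem block_add (a b c d a' b' c' d' : K →L[ℂ] K) :
    block a b c d + block a' b' c' d' = block (a + a') (b + b') (c + c') (d + d') := by
  ext x : 1
  obtain ⟨x, y⟩ := x
  simp only [block_apply, add_apply, ← WithLp.toLp_add, Prod.mk_add_mk]
  congr 2 <;> abel

theorem smul_block (r : ℂ) (a b c d : K →L[ℂ] K) :
    r • block a b c d = block (r • a) (r • b) (r • c) (r • d) := by
  ext x : 1
  obtain ⟨x, y⟩ := x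
  simp only [block_apply, smul_apply, ← WithLp.toLp_smul, Prod.smul_mk,
    smul_add]

theorem block_one : block (1 : K →L[ℂ] K) 0 0 1 = 1 := by
  ext x : 1
  obtain ⟨x, y⟩ := x
  simp [block_apply]

theorem block_inj {a b c d a' b' c' d' : K →L[ℂ] K} (h : block a b c d = block a' b' c' d') :
    a = a' ∧ b = b' ∧ c = c' ∧ d = d' := by
  have h1 : ∀ x, a x = a' x ∧ c x = c' x := fun x => by
    have := DFunLike.congr_fun h (WithLp.toLp 2 (x, 0))
    simpa [block_apply] using this
  have h2 : ∀ x, b x = b' x ∧ d x = d' x := fun x => by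
    have := DFunLike.congr_fun h (WithLp.toLp 2 (0, x))
    simpa [block_apply] using this
  exact ⟨ContinuousLinearMap.ext fun x => (h1 x).1, ContinuousLinearMap.ext fun x => (h2 x).1,
    ContinuousLinearMap.ext fun x => (h1 x).2, ContinuousLinearMap.ext fun x => (h2 x).2⟩

theorem exists_eq_block (A : WithLp 2 (K × K) →L[ℂ] WithLp 2 (K × K)) :
    ∃ a b c d : K →L[ℂ] K, A = block a b c d := by
  let e := (WithLp.prodContinuousLinearEquiv 2 ℂ K K)
  let A' : K × K →L[ℂ] K × K := e.toContinuousLinearMap ∘L A ∘L e.symm.toContinuousLinearMap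
  refine ⟨.fst ℂ K K ∘L A' ∘L .inl ℂ K K, .fst ℂ K K ∘L A' ∘L .inr ℂ K K,
    .snd ℂ K K ∘L A' ∘L .inl ℂ K K, .snd ℂ K K ∘L A' ∘L .inr ℂ K K, ?_⟩
  ext x : 1
  obtain ⟨x, y⟩ := x
  have h : (WithLp.toLp 2 (x, y) : WithLp 2 (K × K)) =
      WithLp.toLp 2 (x, 0) + WithLp.toLp 2 (0, y) := by
    rw [← WithLp.toLp_add]; simp
  rw [block_apply, h, map_add]
  rfl

theorem continuous_block {X : Type*} [TopologicalSpace X] {a b c d : X → K →L[ℂ] K}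
    (ha : Continuous a) (hb : Continuous b) (hc : Continuous c) (hd : Continuous d) :
    Continuous fun x => block (a x) (b x) (c x) (d x) := by
  have h : ∀ x, block (a x) (b x) (c x) (d x) =
      (WithLp.prodContinuousLinearEquiv 2 ℂ K K).symm.toContinuousLinearMap ∘L
        (.inl ℂ K K ∘L (a x ∘L .fst ℂ K K + b x ∘L .snd ℂ K K) +
          .inr ℂ K K ∘L (c x ∘L .fst ℂ K K + d x ∘L .snd ℂ K K)) ∘L
        (WithLp.prodContinuousLinearEquiv 2 ℂ K K).toContinuousLinearMap := fun x => by
    ext y : 1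
    simp [block, ← WithLp.toLp_add]
  simp only [h]
  fun_prop

variable [CompleteSpace K]

theorem star_block (a b c d : K →L[ℂ] K) :
    star (block a b c d) = block (star a) (star c) (star b) (star d) := by
  rw [ContinuousLinearMap.star_eq_adjoint, eq_comm, ContinuousLinearMap.eq_adjoint_iff]
  rintro ⟨x, y⟩ ⟨x', y'⟩
  simp only [block_apply, WithLp.prod_inner_apply, inner_add_left, inner_add_right,
    ContinuousLinearMap.star_eq_adjoint, ContinuousLinearMap.adjoint_inner_left]
  abel

end BlockAlgebra

/-! ### The operator `(I - B²)^{1/2}` and polar decomposition -/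

section OffDiag

variable {K : Type*} [NormedAddCommGroup K] [InnerProductSpace ℂ K] {B : K →L[ℂ] K}

theorem StrictLess.nonneg (h : StrictLess 0 B) : 0 ≤ B :=
  (ContinuousLinearMap.nonneg_iff_isPositive B).2 (by simpa using h.1)

theorem StrictLess.injective (h : StrictLess 0 B) : Function.Injective B := by
  simpa using h.2

theorem eq_of_mul_eq_of_denseRange {a b c : K →L[ℂ] K} (hc : DenseRange c)
    (h : a * c = b * c) : a = b := by
  have : (a : K → K) = b := hc.equalizer a.continuous b.continuous
    (funext fun x => DFunLike.congr_fun h x)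
  exact DFunLike.coe_injective this

variable [CompleteSpace K]

theorem one_sub_mul_self_nonneg (h0 : StrictLess 0 B) (h1 : StrictLess B 1) :
    0 ≤ 1 - B * B := by
  have h2 : 1 - B * B = (1 - B) * (1 + B) := by noncomm_ring
  rw [h2]
  refine Commute.mul_nonneg ((ContinuousLinearMap.nonneg_iff_isPositive _).2 h1.1)
    (add_nonneg zero_le_one h0.nonneg) ?_
  change (1 - B) * (1 + B) = (1 + B) * (1 - B)
  noncomm_ring

theorem offDiag_mul_self (h0 : StrictLess 0 B) (h1 : StrictLess B 1) :
    offDiag B * offDiag B = 1 - B * B :=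
  CFC.sqrt_mul_sqrt_self _ (one_sub_mul_self_nonneg h0 h1)

theorem isSelfAdjoint_offDiag : IsSelfAdjoint (offDiag B) :=
  (CFC.sqrt_nonneg _).isSelfAdjoint

theorem commute_sqrt {A C : K →L[ℂ] K} (h : Commute A C) : Commute (CFC.sqrt A) C := by
  rw [CFC.sqrt_eq_cfc]; exact h.cfc_nnreal _

theorem commute_offDiag {C : K →L[ℂ] K} (h : Commute B C) : Commute (offDiag B) C :=
  commute_sqrt ((Commute.one_left C).sub_left (h.mul_left h))

/-- The square is `(1 - B)(1 + B)`. The first factor is injective by hypothesis, and `Bx = -x`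
contradicts positivity of `B` unless `x = 0`. -/
theorem offDiag_injective (h0 : StrictLess 0 B) (h1 : StrictLess B 1) :
    Function.Injective (offDiag B) := by
  rw [injective_iff_map_eq_zero]
  intro x hx
  have h2 : (1 - B) ((1 + B) x) = 0 := by
    have h3 : (1 - B) * (1 + B) = offDiag B * offDiag B := by
      rw [offDiag_mul_self h0 h1]; noncomm_ring
    rw [← mul_apply_eq_comp, h3, mul_apply_eq_comp, hx, map_zero]
  have h3 : x + B x = 0 := (injective_iff_map_eq_zero (1 - B)).1 h1.2 _ h2
  have h4 : B x = -x := by rw [eq_neg_iff_add_eq_zero, add_comm, h3]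
  have h5 := ((ContinuousLinearMap.nonneg_iff_isPositive B).1 h0.nonneg).re_inner_nonneg_left x
  rw [h4, inner_neg_left, map_neg, inner_self_eq_norm_sq] at h5
  have : ‖x‖ = 0 := by nlinarith [norm_nonneg x]
  exact norm_eq_zero.1 this

/-- An operator anticommuting with `B` commutes with `B²`, hence with its positive square root `B`.
Both relations give `2Ba = 0`, and `B` is injective. -/
theorem eq_zero_of_anticommute (h0 : StrictLess 0 B) {a : K →L[ℂ] K} (h : a * B = -(B * a)) :
    a = 0 := by
  have h2 : Commute (B * B) a := by
    change B * B * a = a * (B * B)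
    rw [← mul_assoc, h, mul_assoc, neg_mul, mul_assoc, h]; simp
  have h3 := commute_sqrt h2
  rw [CFC.sqrt_mul_self B h0.nonneg] at h3
  have h4 : (2 : ℂ) • (B * a) = 0 := by
    rw [two_smul]
    nth_rewrite 1 [h3.eq]
    rw [h, neg_add_cancel]
  have h5 : B * a = 0 := by simpa using h4
  ext x
  apply h0.injective
  simpa using DFunLike.congr_fun h5 x

theorem denseRange_of_injective_star {a : K →L[ℂ] K} (h : Function.Injective ⇑(star a)) :
    DenseRange a := by
  have h1 : a.rangeᗮ = ⊥ := by
    rw [ContinuousLinearMap.orthogonal_range, ← ContinuousLinearMap.star_eq_adjoint]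
    exact LinearMap.ker_eq_bot.2 h
  have h2 := (Submodule.topologicalClosure_eq_top_iff (K := a.range)).2 h1
  have h3 := (Submodule.dense_iff_topologicalClosure_eq_top).2 h2
  exact h3

/-- Polar decomposition of a normal operator `b` with injective modulus `R`; the unitary factor
commutes with every operator that commutes with `b` and `R`. -/
theorem exists_unitary_mul_eq {R b : K →L[ℂ] K} (hR : IsSelfAdjoint R)
    (hRi : Function.Injective R) (h1 : star b * b = R * R) (h2 : b * star b = R * R) :
    ∃ V ∈ unitary (K →L[ℂ] K), V * R = b ∧
      ∀ C, Commute C R → Commute C b → Commute V C := by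
  have hRd : DenseRange R := denseRange_of_injective_star (by rwa [hR.star_eq])
  have hbd : DenseRange b := denseRange_of_injective_star (by
    rw [injective_iff_map_eq_zero]
    intro x hx
    have : R (R x) = 0 := by
      rw [← mul_apply_eq_comp, ← h2, mul_apply_eq_comp, hx, map_zero]
    exact (injective_iff_map_eq_zero R).1 hRi _ ((injective_iff_map_eq_zero R).1 hRi _ this))
  -- Equal norms make `R x ↦ b x` a well-defined isometry between dense subspaces; its extension is
  -- the unitary factor.
  have hn : ∀ x, ‖b x‖ = ‖R x‖ := fun x => by
    have e1 := ContinuousLinearMap.apply_norm_sq_eq_inner_adjoint_left b x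
    have e2 := ContinuousLinearMap.apply_norm_sq_eq_inner_adjoint_left R x
    have e3 : star b * b = star R * R := by rw [h1, hR.star_eq]
    change _ = RCLike.re (inner ℂ ((star b * b) x) x) at e1
    change _ = RCLike.re (inner ℂ ((star R * R) x) x) at e2
    rw [e3, ← e2] at e1
    exact (sq_eq_sq₀ (norm_nonneg _) (norm_nonneg _)).1 e1
  let V := (LinearEquiv.refl ℂ K).extendOfIsometry R.toLinearMap b.toLinearMap hRd hbd hn
  have hV : ∀ x, V (R x) = b x := fun x =>
    LinearEquiv.extendOfIsometry_eq (LinearEquiv.refl ℂ K) R.toLinearMap b.toLinearMap hRd hbd hn x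
  let V' : unitary (K →L[ℂ] K) := Unitary.linearIsometryEquiv.symm V
  have hV' : (V' : K →L[ℂ] K) * R = b := ContinuousLinearMap.ext hV
  refine ⟨V', V'.2, hV', fun C hCR hCb => ?_⟩
  apply eq_of_mul_eq_of_denseRange hRd
  rw [mul_assoc, hCR.eq, ← mul_assoc, hV', mul_assoc, hV', hCb.eq]

end OffDiag

/-! ### Identities for the sum and difference of two idempotents -/

section RingIdentities

theorem sub_mul_eq_neg_of_add_eq {R : Type*} [Ring R] {p q A : R} (hp : p * p = p)
    (hq : q * q = q) (h : p + q = 1 + A) : (p - q) * A = -(A * (p - q)) := by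
  have hA' : A = p + q - 1 := by rw [h]; abel
  rw [hA', ← sub_eq_zero]
  calc (p - q) * (p + q - 1) - -((p + q - 1) * (p - q))
      = 2 * (p * p) - 2 * (q * q) - 2 * p + 2 * q := by noncomm_ring
    _ = 0 := by rw [hp, hq]; noncomm_ring

theorem sub_mul_sub_of_add_eq {R : Type*} [Ring R] {p q A : R} (hp : p * p = p)
    (hq : q * q = q) (h : p + q = 1 + A) : (p - q) * (p - q) = 1 - A * A := by
  have hA' : A = p + q - 1 := by rw [h]; abel
  rw [hA', ← sub_eq_zero]
  calc (p - q) * (p - q) - (1 - (p + q - 1) * (p + q - 1))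
      = 2 * (p * p) + 2 * (q * q) - 2 * p - 2 * q := by noncomm_ring
    _ = 0 := by rw [hp, hq]; noncomm_ring

theorem eq_smul_of_add_eq {R : Type*} [Ring R] [Module ℂ R] {p q A : R}
    (h : p + q = 1 + A) : p = (1 / 2 : ℂ) • (1 + A + (p - q)) := by
  have : 1 + A + (p - q) = (2 : ℂ) • p := by rw [← h, two_smul]; abel
  rw [this, smul_smul]; norm_num

end RingIdentities

/-! ### Pairs of projections on the generic part -/

section BlockPairs

variable {K : Type*} [NormedAddCommGroup K] [InnerProductSpace ℂ K] [CompleteSpace K]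
  {B : K →L[ℂ] K}

/-- The sign of `U` exchanges the two projections, so facts about `blockQ` follow from those about
`blockP`. -/
theorem blockQ_eq_blockP_neg (B U : K →L[ℂ] K) : blockQ B U = blockP B (-U) := by
  simp [blockQ, blockP]

theorem blockP_add_blockQ (B U : K →L[ℂ] K) : blockP B U + blockQ B U = 1 + block B 0 0 (-B) := by
  rw [blockP, blockQ, smul_block, smul_block, block_add, ← block_one, block_add]
  congr 1
  · rw [← two_smul ℂ, smul_smul]; norm_num
  · simp
  · simp
  · rw [← two_smul ℂ, smul_smul, sub_eq_add_neg]; norm_num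

theorem isStarProjection_blockP (h0 : StrictLess 0 B) (h1 : StrictLess B 1) {U : K →L[ℂ] K}
    (hU : U ∈ unitary (K →L[ℂ] K)) (hUB : Commute U B) : IsStarProjection (blockP B U) := by
  have hBs := h0.nonneg.isSelfAdjoint.star_eq
  have hRs := (isSelfAdjoint_offDiag (B := B)).star_eq
  have hRR := offDiag_mul_self h0 h1
  have hRU : Commute (offDiag B) U := commute_offDiag hUB.symm
  have hRB : Commute (offDiag B) B := commute_offDiag (Commute.refl B)
  have hU1 := (Unitary.mem_iff.1 hU).1
  have hU2 := (Unitary.mem_iff.1 hU).2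
  have hUB' := commute_star_of_mem_unitary hU hUB
  set R := offDiag B
  constructor
  · change blockP B U * blockP B U = blockP B U
    rw [blockP, smul_mul_smul_comm, block_mul]
    have e : block ((1 + B) * (1 + B) + R * U * (star U * R)) ((1 + B) * (R * U) + R * U * (1 - B))
        (star U * R * (1 + B) + (1 - B) * (star U * R))
        (star U * R * (R * U) + (1 - B) * (1 - B)) =
        (2 : ℂ) • block (1 + B) (R * U) (star U * R) (1 - B) := by
      rw [smul_block]
      congr 1
      · rw [mul_assoc, ← mul_assoc U, hU2, one_mul, hRR, two_smul]; noncomm_ring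
      · have : R * U * B = B * (R * U) := by rw [mul_assoc, hUB.eq, ← mul_assoc, hRB.eq, mul_assoc]
        rw [mul_sub, this, two_smul]; noncomm_ring
      · have : star U * R * B = B * (star U * R) := by
          rw [mul_assoc, hRB.eq, ← mul_assoc, hUB'.eq, mul_assoc]
        rw [mul_add, this, two_smul]; noncomm_ring
      · have : star U * R * (R * U) = 1 - B * B := by
          rw [hRU.eq, ← mul_assoc, mul_assoc (star U), hRU.eq, ← mul_assoc, hU1, one_mul, hRR]
        rw [this, two_smul]; noncomm_ring
    rw [e, smul_smul]; norm_num; rfl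
  · rw [isSelfAdjoint_iff, blockP, star_smul, star_block]
    simp [hBs, hRs, R]

/-- Pairs of projections on `K ⊕ K` whose sum is `I + (B ⊕ -B)`. -/
theorem exists_eq_blockP (h0 : StrictLess 0 B) (h1 : StrictLess B 1)
    {p q : WithLp 2 (K × K) →L[ℂ] WithLp 2 (K × K)} (hp : IsStarProjection p)
    (hq : IsStarProjection q) (h : p + q = 1 + block B 0 0 (-B)) :
    ∃ U ∈ unitary (K →L[ℂ] K), Commute U B ∧ p = blockP B U := by
  have hpp : p * p = p := hp.1
  have hqq : q * q = q := hq.1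
  set A := block B 0 0 (-B) with hA
  have hanti : (p - q) * A = -(A * (p - q)) := sub_mul_eq_neg_of_add_eq hpp hqq h
  have hsq : (p - q) * (p - q) = 1 - A * A := sub_mul_sub_of_add_eq hpp hqq h
  have hself : star (p - q) = p - q := by
    exact IsSelfAdjoint.sub (R := WithLp 2 (K × K) →L[ℂ] WithLp 2 (K × K)) hp.2 hq.2
  have hp2 : p = (1 / 2 : ℂ) • (1 + A + (p - q)) := eq_smul_of_add_eq h
  -- Anticommutation of `p - q` with `B ⊕ (-B)` reads blockwise: `a` and `d` anticommute with `B`,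
  -- while `b` commutes with it. The square of `p - q` then gives the modulus of `b`.
  obtain ⟨a, b, c, d, hJ⟩ := exists_eq_block (p - q)
  rw [hJ] at hanti hsq hself hp2
  obtain ⟨-, hbc, -, -⟩ := block_inj ((star_block a b c d).symm.trans hself)
  have hneg : ∀ x y z w : K →L[ℂ] K, -block x y z w = block (-x) (-y) (-z) (-w) := by
    intro x y z w
    exact (neg_one_smul ℂ _).symm.trans ((smul_block (-1) x y z w).trans (by simp))
  rw [hA, block_mul, block_mul, hneg] at hanti
  obtain ⟨ha, hb, -, hd⟩ := block_inj hanti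
  simp only [mul_zero, zero_mul, add_zero, zero_add, mul_neg, neg_mul, neg_neg] at ha hb hd
  have ha0 := eq_zero_of_anticommute h0 ha
  have hd0 := eq_zero_of_anticommute h0 (a := d) (by rw [← hd, neg_neg])
  have hbB : Commute b B := neg_injective hb
  have hone : (1 : WithLp 2 (K × K) →L[ℂ] WithLp 2 (K × K)) - A * A =
      block (1 - B * B) 0 0 (1 - B * B) := by
    rw [hA, block_mul, ← block_one, sub_eq_add_neg, hneg, block_add]
    simp [sub_eq_add_neg]
  rw [hone, block_mul] at hsq
  obtain ⟨hbc1, -, -, hbc2⟩ := block_inj hsq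
  have hcb : c = star b := by rw [← hbc, star_star]
  subst ha0 hd0 hcb
  simp only [mul_zero, add_zero, zero_add] at hbc1 hbc2
  rw [← offDiag_mul_self h0 h1] at hbc1 hbc2
  obtain ⟨V, hV, hVb, hVC⟩ := exists_unitary_mul_eq isSelfAdjoint_offDiag
    (offDiag_injective h0 h1) hbc2 hbc1
  have hRB : Commute (offDiag B) B := commute_offDiag (Commute.refl B)
  have hVB : Commute V B := hVC B hRB.symm hbB.symm
  have hRV : Commute (offDiag B) V := commute_offDiag hVB.symm
  refine ⟨V, hV, hVB, ?_⟩
  rw [hp2, blockP, hA, ← block_one, block_add, block_add]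
  have hbR : b = offDiag B * V := by rw [hRV.eq, hVb]
  have hbR' : star b = star V * offDiag B := by
    rw [hbR, star_mul, isSelfAdjoint_offDiag.star_eq]
  rw [hbR', hbR]
  simp [sub_eq_add_neg]

end BlockPairs

/-! ### Extension by zero, compression and transport -/

section Subspaces

variable {H : Type*} [NormedAddCommGroup H] [InnerProductSpace ℂ H]
  (M : Submodule ℂ H) [CompleteSpace M]

theorem extendZero_apply_of_mem (A : M →L[ℂ] M) {x : H} (hx : x ∈ M) :
    extendZero M A x = A ⟨x, hx⟩ := by
  have : M.orthogonalProjectionOnto x = ⟨x, hx⟩ :=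
    M.orthogonalProjectionOnto_mem_subspace_eq_self ⟨x, hx⟩
  simp [extendZero, this]

theorem extendZero_apply_of_mem_orthogonal (A : M →L[ℂ] M) {x : H} (hx : x ∈ Mᗮ) :
    extendZero M A x = 0 := by
  simp [extendZero, Submodule.orthogonalProjectionOnto_apply_of_mem_orthogonal hx]

theorem extendZero_apply_mem (A : M →L[ℂ] M) (x : H) : extendZero M A x ∈ M :=
  (A (M.orthogonalProjectionOnto x)).2

theorem extendZero_mul (A C : M →L[ℂ] M) :
    extendZero M A * extendZero M C = extendZero M (A * C) := by
  ext x
  rw [mul_apply_eq_comp, extendZero_apply_of_mem M A (extendZero_apply_mem M C x)]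
  rfl

theorem extendZero_mul_eq_zero {N : Submodule ℂ H} [CompleteSpace N] (h : N ≤ Mᗮ)
    (A : M →L[ℂ] M) (C : N →L[ℂ] N) : extendZero M A * extendZero N C = 0 := by
  ext x
  exact extendZero_apply_of_mem_orthogonal M A (h (extendZero_apply_mem N C x))

/-- The compression of an operator to a closed subspace. -/
def compress (A : H →L[ℂ] H) : M →L[ℂ] M :=
  M.orthogonalProjectionOnto ∘L A ∘L M.subtypeL

theorem continuous_compress : Continuous (compress M) := by
  unfold compress
  fun_prop

theorem continuous_extendZero : Continuous (extendZero M) := by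
  unfold extendZero
  fun_prop

variable {M}

theorem coe_compress_apply {A : H →L[ℂ] H} (h : ∀ x ∈ M, A x ∈ M) (x : M) :
    (compress M A x : H) = A x :=
  Submodule.starProjection_eq_self_iff.2 (h x x.2)

variable [CompleteSpace H]

variable (M) in
theorem star_extendZero (A : M →L[ℂ] M) : star (extendZero M A) = extendZero M (star A) := by
  rw [ContinuousLinearMap.star_eq_adjoint, extendZero, ContinuousLinearMap.adjoint_comp,
    ContinuousLinearMap.adjoint_comp, Submodule.adjoint_subtypeL,
    Submodule.adjoint_orthogonalProjectionOnto]
  rfl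

variable (M) in
theorem isStarProjection_extendZero {A : M →L[ℂ] M} (hA : IsStarProjection A) :
    IsStarProjection (extendZero M A) :=
  ⟨by rw [IsIdempotentElem, extendZero_mul, hA.1.eq],
    by rw [isSelfAdjoint_iff, star_extendZero, hA.2.star_eq]⟩

theorem isStarProjection_compress {A : H →L[ℂ] H} (hA : IsStarProjection A)
    (h : ∀ x ∈ M, A x ∈ M) : IsStarProjection (compress M A) := by
  constructor
  · ext x
    rw [mul_apply_eq_comp, coe_compress_apply h, coe_compress_apply h]
    exact DFunLike.congr_fun hA.1.eq (x : H)
  · rw [isSelfAdjoint_iff, ContinuousLinearMap.star_eq_adjoint, compress,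
      ContinuousLinearMap.adjoint_comp, ContinuousLinearMap.adjoint_comp,
      Submodule.adjoint_subtypeL, Submodule.adjoint_orthogonalProjectionOnto,
      ← ContinuousLinearMap.star_eq_adjoint, hA.2.star_eq]
    rfl

end Subspaces

theorem isStarProjection_conj {H K : Type*} [NormedAddCommGroup H] [InnerProductSpace ℂ H]
    [CompleteSpace H] [NormedAddCommGroup K] [InnerProductSpace ℂ K] [CompleteSpace K]
    (e : H ≃ₗᵢ[ℂ] K) {A : H →L[ℂ] H} (hA : IsStarProjection A) :
    IsStarProjection (e.toContinuousLinearEquiv.toContinuousLinearMap ∘L A ∘L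
      e.symm.toContinuousLinearEquiv.toContinuousLinearMap) :=
  hA.map e.conjStarAlgEquiv

section Transport

variable {H : Type*} [NormedAddCommGroup H] [InnerProductSpace ℂ H] {T : H →L[ℂ] H}
  {K : Type*} [NormedAddCommGroup K] [InnerProductSpace ℂ K]
  (W : WithLp 2 (K × K) ≃ₗᵢ[ℂ] genericSpace T)

theorem transport_injective : Function.Injective (transport W) := fun A C h => by
  ext x : 1
  have := DFunLike.congr_fun h (W x)
  simpa [transport] using this

theorem transport_add (A C : WithLp 2 (K × K) →L[ℂ] WithLp 2 (K × K)) :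
    transport W (A + C) = transport W A + transport W C := by
  ext x
  simp [transport]

theorem transport_one : transport W 1 = 1 := by
  ext x
  simp [transport]

theorem continuous_transport : Continuous (transport W) := by
  unfold transport
  fun_prop

end Transport

theorem continuous_blockP {K : Type*} [NormedAddCommGroup K] [InnerProductSpace ℂ K]
    [CompleteSpace K] (B : K →L[ℂ] K) : Continuous (blockP B) := by
  have h : Continuous fun U : K →L[ℂ] K =>
      block (1 + B) (offDiag B * U) (star U * offDiag B) (1 - B) :=
    continuous_block (by fun_prop) (by fun_prop) (by fun_prop) (by fun_prop)
  exact Continuous.const_smul h (1 / 2 : ℂ)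

/-! ### Parametrization of all pairs by `E` and `U` -/

section Decomposition

variable {H : Type*} [NormedAddCommGroup H] [InnerProductSpace ℂ H]
  {T : H →L[ℂ] H}

theorem genericSpace_le_orthogonal_zero : genericSpace T ≤ (nullSpace T 0)ᗮ :=
  Submodule.orthogonal_le (le_sup_left.trans le_sup_left)

theorem genericSpace_le_orthogonal_one : genericSpace T ≤ (nullSpace T 1)ᗮ :=
  Submodule.orthogonal_le (le_sup_right.trans le_sup_left)

theorem genericSpace_le_orthogonal_two : genericSpace T ≤ (nullSpace T 2)ᗮ :=
  Submodule.orthogonal_le le_sup_right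

variable [CompleteSpace H]

/-- The conjugate on `ν` comes from the conjugate-linear slot of the inner product. -/
theorem nullSpace_le_orthogonal (hT : IsSelfAdjoint T) {μ ν : ℂ} (h : star ν ≠ μ) :
    nullSpace T μ ≤ (nullSpace T ν)ᗮ := by
  intro x hx y hy
  have h1 := hT.isSymmetric y x
  simp only [ContinuousLinearMap.coe_coe] at h1
  rw [mem_nullSpace.1 hx, mem_nullSpace.1 hy, inner_smul_left, inner_smul_right, ← sub_eq_zero,
    ← sub_mul] at h1
  exact (mul_eq_zero.1 h1).resolve_left (sub_ne_zero.2 h)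

/-- The kernel of `A - C` is closed, so it contains the closure of the sum of the null spaces as
well as its orthogonal complement. Thus closedness of that sum is not needed. -/
theorem ext_on_decomposition {A C : H →L[ℂ] H} (h0 : ∀ x ∈ nullSpace T 0, A x = C x)
    (h1 : ∀ x ∈ nullSpace T 1, A x = C x) (h2 : ∀ x ∈ nullSpace T 2, A x = C x)
    (hG : ∀ x ∈ genericSpace T, A x = C x) : A = C := by
  have hmem : ∀ x, x ∈ (A - C).ker ↔ A x = C x := fun x => by simp [sub_eq_zero]
  set S := nullSpace T 0 ⊔ nullSpace T 1 ⊔ nullSpace T 2 with hS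
  have hle : S ≤ (A - C).ker :=
    sup_le (sup_le (fun x hx => (hmem x).2 (h0 x hx)) fun x hx => (hmem x).2 (h1 x hx))
      fun x hx => (hmem x).2 (h2 x hx)
  have hcl : S.topologicalClosure ≤ (A - C).ker :=
    Submodule.topologicalClosure_minimal _ hle (A - C).isClosed_ker
  have htop : (A - C).ker = ⊤ := by
    rw [eq_top_iff, ← Submodule.sup_orthogonal_of_hasOrthogonalProjection (K := Sᗮ)]
    refine sup_le (fun x hx => (hmem x).2 (hG x hx)) ?_
    rw [Submodule.orthogonal_orthogonal_eq_closure]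
    exact hcl
  ext x
  exact (hmem x).1 (htop ▸ Submodule.mem_top)

variable {K : Type*} [NormedAddCommGroup K] [InnerProductSpace ℂ K] [CompleteSpace K]
  (W : WithLp 2 (K × K) ≃ₗᵢ[ℂ] genericSpace T)

theorem isStarProjection_transport {A : WithLp 2 (K × K) →L[ℂ] WithLp 2 (K × K)}
    (hA : IsStarProjection A) : IsStarProjection (transport W A) :=
  isStarProjection_conj W hA

theorem exists_transport_eq {A : genericSpace T →L[ℂ] genericSpace T} (hA : IsStarProjection A) :
    ∃ p, IsStarProjection p ∧ transport W p = A := by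
  refine ⟨_, isStarProjection_conj W.symm hA, ?_⟩
  ext x
  simp [transport]

variable {B : K →L[ℂ] K} {E : nullSpace T 1 →L[ℂ] nullSpace T 1} {U : K →L[ℂ] K}

theorem repP_apply_zero (hT : IsSelfAdjoint T) {x : H} (hx : x ∈ nullSpace T 0) :
    repP W B E U x = 0 := by
  have h1 := nullSpace_le_orthogonal hT (μ := 0) (ν := 1) (by simp) hx
  have h2 := nullSpace_le_orthogonal hT (μ := 0) (ν := 2) (by simp) hx
  have hG : x ∈ (genericSpace T)ᗮ :=
    Submodule.le_orthogonal_iff_le_orthogonal.1 genericSpace_le_orthogonal_zero hx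
  rw [repP, add_apply, add_apply, extendZero_apply_of_mem_orthogonal _ _ h1,
    extendZero_apply_of_mem_orthogonal _ _ h2, extendZero_apply_of_mem_orthogonal _ _ hG]
  simp

theorem repP_apply_one (hT : IsSelfAdjoint T) {x : H} (hx : x ∈ nullSpace T 1) :
    repP W B E U x = E ⟨x, hx⟩ := by
  have h2 := nullSpace_le_orthogonal hT (μ := 1) (ν := 2) (by simp) hx
  have hG : x ∈ (genericSpace T)ᗮ :=
    Submodule.le_orthogonal_iff_le_orthogonal.1 genericSpace_le_orthogonal_one hx
  rw [repP, add_apply, add_apply, extendZero_apply_of_mem _ _ hx,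
    extendZero_apply_of_mem_orthogonal _ _ h2, extendZero_apply_of_mem_orthogonal _ _ hG]
  simp

theorem repP_apply_two (hT : IsSelfAdjoint T) {x : H} (hx : x ∈ nullSpace T 2) :
    repP W B E U x = x := by
  have h1 := nullSpace_le_orthogonal hT (μ := 2) (ν := 1) (by simp) hx
  have hG : x ∈ (genericSpace T)ᗮ :=
    Submodule.le_orthogonal_iff_le_orthogonal.1 genericSpace_le_orthogonal_two hx
  rw [repP, add_apply, add_apply, extendZero_apply_of_mem_orthogonal _ _ h1,
    extendZero_apply_of_mem _ _ hx, extendZero_apply_of_mem_orthogonal _ _ hG]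
  simp

theorem repP_apply_generic {x : H} (hx : x ∈ genericSpace T) :
    repP W B E U x = transport W (blockP B U) ⟨x, hx⟩ := by
  rw [repP, add_apply, add_apply,
    extendZero_apply_of_mem_orthogonal _ _ (genericSpace_le_orthogonal_one hx),
    extendZero_apply_of_mem_orthogonal _ _ (genericSpace_le_orthogonal_two hx),
    extendZero_apply_of_mem _ _ hx]
  simp

/-- This reduces every statement about the second projection to the first. -/
theorem repQ_eq_repP : repQ W B E U = repP W B (1 - E) (-U) := by
  rw [repQ, repP, blockQ_eq_blockP_neg]

theorem isStarProjection_repP (hT : IsSelfAdjoint T) (h0 : StrictLess 0 B) (h1 : StrictLess B 1)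
    (hE : IsStarProjection E) (hU : U ∈ unitary (K →L[ℂ] K)) (hUB : Commute U B) :
    IsStarProjection (repP W B E U) := by
  refine ((isStarProjection_extendZero _ hE).add
    (isStarProjection_extendZero _
      (IsStarProjection.one (nullSpace T 2 →L[ℂ] nullSpace T 2))) ?_).add
    (isStarProjection_extendZero _
      (isStarProjection_transport W (isStarProjection_blockP h0 h1 hU hUB))) ?_
  · exact extendZero_mul_eq_zero _ (nullSpace_le_orthogonal hT (by simp)) _ _
  · rw [add_mul, extendZero_mul_eq_zero _ genericSpace_le_orthogonal_one,
      extendZero_mul_eq_zero _ genericSpace_le_orthogonal_two, add_zero]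

theorem repP_add_repQ (hT : IsSelfAdjoint T)
    (hW : genericPart T - 1 = transport W (block B 0 0 (-B))) :
    repP W B E U + repQ W B E U = T := by
  rw [repQ_eq_repP]
  refine ext_on_decomposition (T := T) (fun x hx => ?_) (fun x hx => ?_) (fun x hx => ?_)
    fun x hx => ?_
  · rw [add_apply, repP_apply_zero W hT hx, repP_apply_zero W hT hx, mem_nullSpace.1 hx]; simp
  · rw [add_apply, repP_apply_one W hT hx, repP_apply_one W hT hx, mem_nullSpace.1 hx]; simp
  · rw [add_apply, repP_apply_two W hT hx, repP_apply_two W hT hx, mem_nullSpace.1 hx, two_smul]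
  · rw [add_apply, repP_apply_generic W hx, repP_apply_generic W hx, ← Submodule.coe_add,
      ← add_apply, ← blockQ_eq_blockP_neg]
    have h : transport W (blockP B U) + transport W (blockQ B U) = genericPart T := by
      rw [← sub_add_cancel (genericPart T) 1, hW, ← transport_add, blockP_add_blockQ,
        transport_add, transport_one, add_comm]
    rw [h, coe_genericPart hT]

/-- The parameter `E` is thereby a continuous function of the pair; this is the invariant that
separates components. -/
theorem compress_repP (hT : IsSelfAdjoint T) : compress (nullSpace T 1) (repP W B E U) = E := by
  ext x
  have h : ∀ x ∈ nullSpace T 1, repP W B E U x ∈ nullSpace T 1 := fun x hx => by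
    rw [repP_apply_one W hT hx]; exact Subtype.prop _
  rw [coe_compress_apply h, repP_apply_one W hT x.2]

section Pairs

variable {P Q : H →L[ℂ] H}

/-- For projections, `‖Px‖² + ‖Qx‖²` is the real part of `⟪(P + Q)x, x⟫`. -/
theorem apply_eq_zero_of_add_apply_eq_zero (hP : IsStarProjection P) (hQ : IsStarProjection Q)
    {x : H} (h : P x + Q x = 0) : P x = 0 := by
  have key : ∀ {R : H →L[ℂ] H}, IsStarProjection R → RCLike.re (inner ℂ (R x) x) = ‖R x‖ ^ 2 := by
    intro R hR
    rw [ContinuousLinearMap.apply_norm_sq_eq_inner_adjoint_left, ←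
      ContinuousLinearMap.star_eq_adjoint, hR.2.star_eq]
    congr 2
    exact (DFunLike.congr_fun hR.1.eq x).symm
  have h2 : ‖P x‖ ^ 2 + ‖Q x‖ ^ 2 = 0 := by
    rw [← key hP, ← key hQ, ← map_add, ← inner_add_left, h]; simp
  have : ‖P x‖ = 0 := by nlinarith [norm_nonneg (P x), sq_nonneg ‖P x‖, sq_nonneg ‖Q x‖]
  exact norm_eq_zero.1 this

theorem apply_eq_zero_of_mem_nullSpace_zero (hP : IsStarProjection P) (hQ : IsStarProjection Q)
    {x : H} (hx : x ∈ nullSpace (P + Q) 0) : P x = 0 :=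
  apply_eq_zero_of_add_apply_eq_zero hP hQ (by simpa using mem_nullSpace.1 hx)

theorem apply_eq_self_of_mem_nullSpace_two (hP : IsStarProjection P) (hQ : IsStarProjection Q)
    {x : H} (hx : x ∈ nullSpace (P + Q) 2) : P x = x := by
  have h := mem_nullSpace.1 hx
  rw [add_apply, two_smul] at h
  -- At the eigenvalue `2` the complementary projections sum to zero on `x`.
  have := apply_eq_zero_of_add_apply_eq_zero hP.one_sub hQ.one_sub (x := x) (by
    simp only [sub_apply, one_apply_eq_self]
    rw [sub_add_sub_comm, h, sub_self])
  simp only [sub_apply, one_apply_eq_self] at this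
  exact (sub_eq_zero.1 this).symm

theorem apply_mem_nullSpace_one (hP : IsStarProjection P) (hQ : IsStarProjection Q)
    {x : H} (hx : x ∈ nullSpace (P + Q) 1) : P x ∈ nullSpace (P + Q) 1 := by
  have h := mem_nullSpace.1 hx
  rw [add_apply, one_smul] at h
  have hP2 : P (P x) = P x := DFunLike.congr_fun hP.1.eq x
  have hQ2 : Q (Q x) = Q x := DFunLike.congr_fun hQ.1.eq x
  -- Applying `Q` to `Px + Qx = x` leaves `QPx = 0`.
  have h2 : Q (P x) = 0 := by
    have := congrArg Q h
    rw [map_add, hQ2] at this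
    simpa using this
  rw [mem_nullSpace, add_apply, hP2, h2, add_zero, one_smul]

theorem apply_mem_genericSpace_of_add (hP : IsStarProjection P) (hQ : IsStarProjection Q)
    {x : H} (hx : x ∈ genericSpace (P + Q)) : P x ∈ genericSpace (P + Q) := by
  intro y hy
  have h := hP.2.isSymmetric y x
  simp only [ContinuousLinearMap.coe_coe] at h
  rw [← h]
  refine hx _ ?_
  obtain ⟨u, hu, c, hc, rfl⟩ := Submodule.mem_sup.1 hy
  obtain ⟨a, ha, b, hb, rfl⟩ := Submodule.mem_sup.1 hu
  rw [map_add, map_add]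
  refine Submodule.add_mem_sup (Submodule.add_mem_sup ?_ (apply_mem_nullSpace_one hP hQ hb)) ?_
  · rw [apply_eq_zero_of_mem_nullSpace_zero hP hQ ha]; exact Submodule.zero_mem _
  · rwa [apply_eq_self_of_mem_nullSpace_two hP hQ hc]

end Pairs

theorem pairs_eq_repPairs (hT : IsSelfAdjoint T) (h0 : StrictLess 0 B) (h1 : StrictLess B 1)
    (hW : genericPart T - 1 = transport W (block B 0 0 (-B))) :
    pairs T = repPairs W B fun _ => True := by
  ext ⟨P, Q⟩
  constructor
  · rintro ⟨hP, hQ, hPQ⟩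
    change IsStarProjection P at hP
    change IsStarProjection Q at hQ
    change T = P + Q at hPQ
    have hN1 : ∀ x ∈ nullSpace T 1, P x ∈ nullSpace T 1 := fun x hx => by
      rw [hPQ] at hx ⊢; exact apply_mem_nullSpace_one hP hQ hx
    have hGP : ∀ x ∈ genericSpace T, P x ∈ genericSpace T := fun x hx => by
      rw [hPQ] at hx ⊢; exact apply_mem_genericSpace_of_add hP hQ hx
    have hGQ : ∀ x ∈ genericSpace T, Q x ∈ genericSpace T := fun x hx => by
      rw [hPQ, add_comm] at hx ⊢; exact apply_mem_genericSpace_of_add hQ hP hx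
    obtain ⟨p, hp, hpP⟩ := exists_transport_eq W (isStarProjection_compress hP hGP)
    obtain ⟨q, hq, hqQ⟩ := exists_transport_eq W (isStarProjection_compress hQ hGQ)
    have hsum : p + q = 1 + block B 0 0 (-B) := by
      apply transport_injective W
      rw [transport_add, transport_add, transport_one, hpP, hqQ, ← hW, add_sub_cancel]
      ext x
      rw [add_apply, Submodule.coe_add, coe_compress_apply hGP, coe_compress_apply hGQ,
        coe_genericPart hT, ← add_apply]
      exact congrArg (fun A : H →L[ℂ] H => A x) hPQ.symm
    obtain ⟨U, hU, hUB, rfl⟩ := exists_eq_blockP h0 h1 hp hq hsum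
    have hrep : P = repP W B (compress (nullSpace T 1) P) U := by
      refine ext_on_decomposition (T := T) (fun x hx => ?_) (fun x hx => ?_) (fun x hx => ?_)
        fun x hx => ?_
      · rw [repP_apply_zero W hT hx]
        rw [hPQ] at hx
        exact apply_eq_zero_of_mem_nullSpace_zero hP hQ hx
      · rw [repP_apply_one W hT hx, coe_compress_apply hN1]
      · rw [repP_apply_two W hT hx]
        rw [hPQ] at hx
        exact apply_eq_self_of_mem_nullSpace_two hP hQ hx
      · rw [repP_apply_generic W hx, hpP, coe_compress_apply hGP]
    refine ⟨_, U, isStarProjection_compress hP hN1, trivial, hU, hUB, Prod.ext hrep ?_⟩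
    -- Once `P` has the required form, `Q = T - P` has it too.
    have hT' := repP_add_repQ W (E := compress (nullSpace T 1) P) (U := U) hT hW
    rw [← hrep] at hT'
    exact (add_left_cancel (hT'.trans hPQ)).symm
  · rintro ⟨E, U, hE, -, hU, hUB, h⟩
    obtain ⟨rfl, rfl⟩ := Prod.mk.inj h
    refine ⟨isStarProjection_repP W hT h0 h1 hE hU hUB, ?_, (repP_add_repQ W hT hW).symm⟩
    simp only
    rw [repQ_eq_repP]
    exact isStarProjection_repP W hT h0 h1
      (IsStarProjection.one_sub (R := nullSpace T 1 →L[ℂ] nullSpace T 1) hE)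
      (by rw [Unitary.mem_iff] at hU ⊢; simpa using hU) hUB.neg_left

theorem continuous_repP {X : Type*} [TopologicalSpace X]
    {E : X → nullSpace T 1 →L[ℂ] nullSpace T 1} {U : X → K →L[ℂ] K} (hE : Continuous E)
    (hU : Continuous U) : Continuous fun x => repP W B (E x) (U x) := by
  have h1 : Continuous fun x => extendZero (nullSpace T 1) (E x) :=
    (continuous_extendZero _).comp hE
  have h2 : Continuous fun x => extendZero (genericSpace T) (transport W (blockP B (U x))) :=
    (continuous_extendZero _).comp ((continuous_transport W).comp ((continuous_blockP B).comp hU))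
  exact (h1.add continuous_const).add h2

theorem continuous_repP_repQ {X : Type*} [TopologicalSpace X]
    {E : X → nullSpace T 1 →L[ℂ] nullSpace T 1} {U : X → K →L[ℂ] K} (hE : Continuous E)
    (hU : Continuous U) : Continuous fun x => (repP W B (E x) (U x), repQ W B (E x) (U x)) := by
  have h : Continuous fun x => 1 - E x := continuous_const.sub hE
  simp only [repQ_eq_repP]
  exact (continuous_repP W hE hU).prodMk (continuous_repP W h hU.neg)

end Decomposition

/-! ### Unitaries assembled from orthogonal pieces -/

section Glue

variable {N : Type*} [NormedAddCommGroup N] [InnerProductSpace ℂ N]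

theorem exists_linearIsometryEquiv_glue (M M' : Submodule ℂ N) [M.HasOrthogonalProjection]
    [M'.HasOrthogonalProjection] (e : M ≃ₗᵢ[ℂ] M') (f : Mᗮ ≃ₗᵢ[ℂ] M'ᗮ) :
    ∃ V : N ≃ₗᵢ[ℂ] N, ∀ x : M, V x = e x := by
  let g : WithLp 2 (M × Mᗮ) ≃ₗᵢ[ℂ] WithLp 2 (M' × M'ᗮ) :=
    { (WithLp.linearEquiv 2 ℂ (M × Mᗮ)) ≪≫ₗ (e.toLinearEquiv.prodCongr f.toLinearEquiv) ≪≫ₗ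
        (WithLp.linearEquiv 2 ℂ (M' × M'ᗮ)).symm with
      norm_map' := fun x => by
        rw [WithLp.prod_norm_eq_of_L2, WithLp.prod_norm_eq_of_L2]
        simp }
  refine ⟨M.orthogonalDecomposition.trans (g.trans M'.orthogonalDecomposition.symm), fun x => ?_⟩
  have h1 : M.orthogonalDecomposition (x : N) = WithLp.toLp 2 (x, 0) := by
    rw [Submodule.orthogonalDecomposition_apply,
      Submodule.orthogonalProjectionOnto_mem_subspace_eq_self,
      Submodule.orthogonalProjectionOnto_orthogonal_apply_eq_zero x.2]
  have h2 : g (WithLp.toLp 2 (x, 0)) = WithLp.toLp 2 (e x, 0) := by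
    change WithLp.toLp 2 (e x, f 0) = _
    rw [map_zero]
  have h3 : M'.orthogonalDecomposition (e x : N) = WithLp.toLp 2 (e x, 0) := by
    rw [Submodule.orthogonalDecomposition_apply,
      Submodule.orthogonalProjectionOnto_mem_subspace_eq_self,
      Submodule.orthogonalProjectionOnto_orthogonal_apply_eq_zero (e x).2]
  rw [LinearIsometryEquiv.trans_apply, LinearIsometryEquiv.trans_apply, h1, h2, ← h3,
    LinearIsometryEquiv.symm_apply_apply]

theorem finiteDimensional_of_range {E : N →L[ℂ] N} (h1 : FiniteDimensional ℂ E.range)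
    (h2 : FiniteDimensional ℂ (1 - E).range) : FiniteDimensional ℂ N := by
  have : E.range ⊔ (1 - E).range = ⊤ := by
    rw [eq_top_iff]
    intro x _
    exact Submodule.mem_sup.2 ⟨E x, ⟨x, rfl⟩, (1 - E) x, ⟨x, rfl⟩, by simp⟩
  have h3 : FiniteDimensional ℂ (⊤ : Submodule ℂ N) := this ▸ Submodule.finiteDimensional_sup _ _
  exact Module.finite_def.2 ((Submodule.fg_top _).1 (Module.finite_def.1 h3))

end Glue

/-! ### Unitary equivalence of projections -/

section UnitaryEquivalence

variable {N : Type*} [NormedAddCommGroup N] [InnerProductSpace ℂ N] [CompleteSpace N]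
  {E F G : N →L[ℂ] N}

theorem UnitarilyEquiv.refl (E : N →L[ℂ] N) : UnitarilyEquiv E E := ⟨1, one_mem _, by simp⟩

theorem UnitarilyEquiv.symm (h : UnitarilyEquiv E F) : UnitarilyEquiv F E := by
  obtain ⟨V, hV, rfl⟩ := h
  refine ⟨star V, Unitary.star_mem hV, ?_⟩
  have h1 := (Unitary.mem_iff.1 hV).1
  rw [star_star, mul_assoc, mul_assoc, h1, mul_one, ← mul_assoc, h1, one_mul]

theorem UnitarilyEquiv.trans (h : UnitarilyEquiv E F) (h' : UnitarilyEquiv F G) :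
    UnitarilyEquiv E G := by
  obtain ⟨V, hV, rfl⟩ := h
  obtain ⟨V', hV', rfl⟩ := h'
  exact ⟨V' * V, mul_mem hV' hV, by simp only [star_mul, mul_assoc]⟩

theorem UnitarilyEquiv.one_sub (h : UnitarilyEquiv E F) : UnitarilyEquiv (1 - E) (1 - F) := by
  obtain ⟨V, hV, rfl⟩ := h
  refine ⟨V, hV, ?_⟩
  rw [mul_sub, sub_mul, mul_one, (Unitary.mem_iff.1 hV).2]

theorem UnitarilyEquiv.of_one_sub (h : UnitarilyEquiv (1 - E) (1 - F)) : UnitarilyEquiv E F := by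
  have := h.one_sub
  rwa [sub_sub_cancel, sub_sub_cancel] at this

theorem UnitarilyEquiv.isStarProjection (h : UnitarilyEquiv E F) (hE : IsStarProjection E) :
    IsStarProjection F := by
  obtain ⟨V, hV, rfl⟩ := h
  have h1 := (Unitary.mem_iff.1 hV).1
  constructor
  · change V * E * star V * (V * E * star V) = V * E * star V
    calc V * E * star V * (V * E * star V) = V * (E * (star V * V) * E) * star V := by
          simp only [mul_assoc]
      _ = V * E * star V := by rw [h1, mul_one, hE.1.eq]
  · rw [isSelfAdjoint_iff]
    simp only [star_mul, star_star, hE.2.star_eq, mul_assoc]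

theorem UnitarilyEquiv.hdim_range_eq (h : UnitarilyEquiv E F) : hdim E.range = hdim F.range := by
  have key : ∀ {E F : N →L[ℂ] N}, UnitarilyEquiv E F → hdim F.range ≤ hdim E.range := by
    rintro E _ ⟨V, -, rfl⟩
    refine Cardinal.toENat.monotone' ?_
    have h1 : (V * E * star V).toLinearMap.rank ≤ (V * E).toLinearMap.rank :=
      LinearMap.rank_comp_le_left _ _
    have h2 : (V * E).toLinearMap.rank ≤ E.toLinearMap.rank := LinearMap.rank_comp_le_right _ _
    exact h1.trans h2
  exact le_antisymm (key h.symm) (key h)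

/-- The orbit is a continuous image of the full unitary group, which is the unitary commutant of
`1`. -/
theorem isPreconnected_unitarilyEquiv (E : N →L[ℂ] N) :
    IsPreconnected {F : N →L[ℂ] N | UnitarilyEquiv E F} := by
  have hc : Continuous fun V : N →L[ℂ] N => V * E * star V := by fun_prop
  convert! (isPreconnected_unitary_commutant (IsSelfAdjoint.one (N →L[ℂ] N))).image _
    hc.continuousOn using 1
  ext F
  constructor
  · rintro ⟨V, hV, rfl⟩
    exact ⟨V, ⟨hV, Commute.one_right V⟩, rfl⟩
  · rintro ⟨V, ⟨hV, -⟩, rfl⟩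
    exact ⟨V, hV, rfl⟩

open Topology in
theorem eventually_unitarilyEquiv (hE : IsStarProjection E) :
    ∀ᶠ F in 𝓝 E, IsStarProjection F → UnitarilyEquiv E F := by
  filter_upwards [Metric.ball_mem_nhds E one_pos] with F hF hF'
  refine exists_unitary_conj_of_norm_sub_lt_one hE hF' ?_
  rw [norm_sub_rev, ← dist_eq_norm]
  exact hF

theorem apply_eq_self_of_mem_range (hE : IsStarProjection E) {x : N} (hx : x ∈ E.range) :
    E x = x := by
  obtain ⟨y, rfl⟩ := hx
  exact DFunLike.congr_fun hE.1.eq y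

theorem range_one_sub (hE : IsStarProjection E) : (1 - E).range = E.rangeᗮ := by
  rw [ContinuousLinearMap.orthogonal_range, ← ContinuousLinearMap.star_eq_adjoint, hE.2.star_eq]
  ext x
  constructor
  · rintro ⟨y, rfl⟩
    exact DFunLike.congr_fun hE.mul_one_sub_self y
  · intro hx
    refine ⟨x, ?_⟩
    have : E x = 0 := hx
    simp [this]

/-- A unitary matching the ranges also matches their orthogonal complements, hence intertwines the
projections. -/
theorem unitarilyEquiv_of_linearIsometryEquiv (hE : IsStarProjection E) (hF : IsStarProjection F)
    (V : N ≃ₗᵢ[ℂ] N) (h : ∀ x, V x ∈ F.range ↔ x ∈ E.range) : UnitarilyEquiv E F := by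
  let V' : unitary (N →L[ℂ] N) := Unitary.linearIsometryEquiv.symm V
  have hFV : F * (V' : N →L[ℂ] N) = V' * E := by
    ext x
    have h1 : F (V (E x)) = V (E x) := apply_eq_self_of_mem_range hF ((h _).2 ⟨x, rfl⟩)
    have h2 : F (V ((1 - E) x)) = 0 := by
      have h3 : V ((1 - E) x) ∈ F.rangeᗮ := by
        intro y hy
        rw [← V.apply_symm_apply y, V.inner_map_map]
        have h4 : (1 - E) x ∈ E.rangeᗮ := range_one_sub hE ▸ ⟨x, rfl⟩
        exact h4 _ ((h _).1 (by rwa [V.apply_symm_apply]))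
      rw [← range_one_sub hF] at h3
      have := apply_eq_self_of_mem_range hF.one_sub h3
      simpa using this
    change F (V x) = V (E x)
    rw [← h1, ← sub_eq_zero, ← map_sub, ← map_sub, ← h2]
    simp
  refine ⟨V', V'.2, ?_⟩
  rw [← hFV, mul_assoc, (Unitary.mem_iff.1 V'.2).2, mul_one]

/-- Finite-rank projections of equal rank are unitarily equivalent. -/
theorem unitarilyEquiv_of_hdim_range_eq (hE : IsStarProjection E) (hF : IsStarProjection F) {k : ℕ}
    (h1 : hdim E.range = k) (h2 : hdim F.range = k) : UnitarilyEquiv E F := by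
  rw [hdim, Cardinal.toENat_eq_natCast] at h1 h2
  have : FiniteDimensional ℂ E.range :=
    Module.rank_lt_aleph0_iff.1 (h1 ▸ Cardinal.natCast_lt_aleph0)
  have : FiniteDimensional ℂ F.range :=
    Module.rank_lt_aleph0_iff.1 (h2 ▸ Cardinal.natCast_lt_aleph0)
  have hfin : Module.finrank ℂ E.range = Module.finrank ℂ F.range := by
    rw [Module.finrank, Module.finrank, h1, h2]
  let e : E.range ≃ₗᵢ[ℂ] F.range :=
    (stdOrthonormalBasis ℂ E.range).equiv (stdOrthonormalBasis ℂ F.range) (finCongr hfin)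
  -- Inside this finite-dimensional space the isometry between the two ranges extends to a unitary;
  -- on `Mᗮ` the identity completes it. This avoids comparing the possibly infinite-dimensional
  -- complements of the ranges.
  set M := E.range ⊔ F.range with hM
  have hEM : E.range ≤ M := le_sup_left
  have hFM : F.range ≤ M := le_sup_right
  let S : Submodule ℂ M := E.range.comap M.subtype
  let L : S →ₗᵢ[ℂ] M :=
    { toFun := fun x => ⟨e ⟨x.1.1, x.2⟩, hFM (e _).2⟩
      map_add' := fun x y =>
        Subtype.ext (congrArg (fun z : F.range => (z : N)) (e.map_add ⟨x.1.1, x.2⟩ ⟨y.1.1, y.2⟩))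
      map_smul' := fun c x =>
        Subtype.ext (congrArg (fun z : F.range => (z : N)) (e.map_smul c ⟨x.1.1, x.2⟩))
      norm_map' := fun x => e.norm_map ⟨x.1.1, x.2⟩ }
  let L' : M ≃ₗᵢ[ℂ] M := L.extend.toLinearIsometryEquiv rfl
  obtain ⟨V, hV⟩ := exists_linearIsometryEquiv_glue M M L' (.refl ℂ _)
  have hVe : ∀ x : E.range, V x = e x := fun x => by
    rw [hV ⟨x, hEM x.2⟩]
    exact congrArg Subtype.val (L.extend_apply (⟨⟨x, hEM x.2⟩, x.2⟩ : S))
  refine unitarilyEquiv_of_linearIsometryEquiv hE hF V fun x => ⟨fun hx => ?_, fun hx => ?_⟩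
  · have h3 := hVe (e.symm ⟨V x, hx⟩)
    rw [e.apply_symm_apply] at h3
    rw [← V.injective h3]
    exact Subtype.prop _
  · rw [hVe ⟨x, hx⟩]
    exact Subtype.prop _

theorem unitarilyEquiv_of_hdim_range_one_sub_eq (hE : IsStarProjection E)
    (hF : IsStarProjection F) {k : ℕ} (h1 : hdim (1 - E).range = k)
    (h2 : hdim (1 - F).range = k) : UnitarilyEquiv E F :=
  (unitarilyEquiv_of_hdim_range_eq hE.one_sub hF.one_sub h1 h2).of_one_sub

end UnitaryEquivalence

/-! ### Separable spaces and existence of projections of given rank -/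

section Separable

theorem hdim_eq_top_iff {V : Type*} [AddCommGroup V] [Module ℂ V] {M : Submodule ℂ V} :
    hdim M = ⊤ ↔ ¬ FiniteDimensional ℂ M := by
  rw [hdim, Cardinal.toENat_eq_top, ← not_lt, Module.rank_lt_aleph0_iff]

theorem hdim_eq_top_of_linearIndependent {V : Type*} [AddCommGroup V] [Module ℂ V]
    {M : Submodule ℂ V} {v : ℕ → V} (hv : LinearIndependent ℂ v) (hM : ∀ n, v n ∈ M) :
    hdim M = ⊤ := by
  rw [hdim_eq_top_iff]
  intro h
  have hli : LinearIndependent ℂ fun n => (⟨v n, hM n⟩ : M) :=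
    LinearIndependent.of_comp M.subtype hv
  exact Module.Finite.not_linearIndependent_of_infinite _ hli

/-- Orthonormal vectors lie `√2` apart, so the balls of radius `1/2` around them are disjoint open
sets. -/
theorem countable_of_orthonormal {E : Type*} [NormedAddCommGroup E] [InnerProductSpace ℂ E]
    [TopologicalSpace.SeparableSpace E] {ι : Type*} {v : ι → E} (hv : Orthonormal ℂ v) :
    Countable ι := by
  have h : (Set.univ : Set ι).PairwiseDisjoint fun i => Metric.ball (v i) (1 / 2) := by
    intro i _ j _ hij
    refine Metric.ball_disjoint_ball ?_
    have h1 : ‖v i - v j‖ ^ 2 = 2 := by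
      rw [@norm_sub_sq ℂ, hv.1 i, hv.1 j, hv.2 hij]; norm_num
    rw [dist_eq_norm]
    nlinarith [norm_nonneg (v i - v j)]
  exact Set.countable_univ_iff.1 (h.countable_of_isOpen (fun _ _ => Metric.isOpen_ball)
    fun i _ => ⟨v i, Metric.mem_ball_self (by norm_num)⟩)

theorem nonempty_hilbertBasis_nat {E : Type*} [NormedAddCommGroup E] [InnerProductSpace ℂ E]
    [CompleteSpace E] [TopologicalSpace.SeparableSpace E] (h : ¬ FiniteDimensional ℂ E) :
    Nonempty (HilbertBasis ℕ ℂ E) := by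
  obtain ⟨w, b, -⟩ := exists_hilbertBasis ℂ E
  have hc : Countable w := countable_of_orthonormal b.orthonormal
  have hi : Infinite w := by
    by_contra hfin
    rw [not_infinite_iff_finite] at hfin
    have := Fintype.ofFinite w
    exact h b.toOrthonormalBasis.toBasis.finiteDimensional_of_finite
  obtain ⟨e⟩ := nonempty_equiv_of_countable (α := ℕ) (β := w)
  refine ⟨HilbertBasis.mk (v := b ∘ e) (b.orthonormal.comp e e.injective) ?_⟩
  rw [e.surjective.range_comp, b.dense_span]

variable {N : Type*} [NormedAddCommGroup N] [InnerProductSpace ℂ N] [CompleteSpace N]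
  {E F : N →L[ℂ] N}

theorem isClosed_range (hE : IsStarProjection E) : IsClosed (E.range : Set N) := by
  have : (E.range : Set N) = ((1 - E).ker : Set N) := by
    ext x
    constructor
    · intro hx
      have := apply_eq_self_of_mem_range hE hx
      simp [this]
    · intro hx
      have : x - E x = 0 := by simpa using hx
      exact ⟨x, (sub_eq_zero.1 this).symm⟩
  rw [this]
  exact (1 - E).isClosed_ker

theorem unitarilyEquiv_of_separableSpace [TopologicalSpace.SeparableSpace N]
    (hE : IsStarProjection E) (hF : IsStarProjection F) (h1 : hdim E.range = ⊤)
    (h2 : hdim (1 - E).range = ⊤) (h3 : hdim F.range = ⊤) (h4 : hdim (1 - F).range = ⊤) :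
    UnitarilyEquiv E F := by
  rw [range_one_sub hE] at h2
  rw [range_one_sub hF] at h4
  rw [hdim_eq_top_iff] at h1 h2 h3 h4
  have : CompleteSpace E.range := (isClosed_range hE).completeSpace_coe
  have : CompleteSpace F.range := (isClosed_range hF).completeSpace_coe
  have : SecondCountableTopology N := UniformSpace.secondCountable_of_separable N
  obtain ⟨b1⟩ := nonempty_hilbertBasis_nat h1
  obtain ⟨b2⟩ := nonempty_hilbertBasis_nat h2
  obtain ⟨b3⟩ := nonempty_hilbertBasis_nat h3
  obtain ⟨b4⟩ := nonempty_hilbertBasis_nat h4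
  let e := b1.repr.trans b3.repr.symm
  obtain ⟨V, hV⟩ := exists_linearIsometryEquiv_glue E.range F.range e
    (b2.repr.trans b4.repr.symm)
  refine unitarilyEquiv_of_linearIsometryEquiv hE hF V fun x => ⟨fun hx => ?_, fun hx => ?_⟩
  · have h3 := hV (e.symm ⟨V x, hx⟩)
    rw [e.apply_symm_apply] at h3
    rw [← V.injective h3]
    exact Subtype.prop _
  · rw [hV ⟨x, hx⟩]
    exact Subtype.prop _

theorem exists_isStarProjection_hdim_range_eq {k : ℕ}
    (h : (k : ℕ∞) ≤ Cardinal.toENat (Module.rank ℂ N)) :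
    ∃ E : N →L[ℂ] N, IsStarProjection E ∧ hdim E.range = k := by
  have h' : (k : Cardinal) ≤ Module.rank ℂ N := by
    rw [← Cardinal.toENat_nat] at h
    exact (Cardinal.toENat_le_iff_of_le_aleph0 Cardinal.natCast_le_aleph0).1 h
  obtain ⟨s, hs, hli⟩ := exists_finset_linearIndependent_of_le_rank h'
  have hfin : Module.finrank ℂ (Submodule.span ℂ (s : Set N)) = k := by
    rw [finrank_span_finset_eq_card hli, hs]
  have : FiniteDimensional ℂ (Submodule.span ℂ (s : Set N)) :=
    FiniteDimensional.span_finset ℂ s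
  refine ⟨(Submodule.span ℂ (s : Set N)).starProjection, isStarProjection_starProjection, ?_⟩
  rw [Submodule.range_starProjection, hdim, ← Module.finrank_eq_rank, hfin, Cardinal.toENat_nat]

theorem exists_isStarProjection_hdim_range_eq_top [TopologicalSpace.SeparableSpace N]
    (h : ¬ FiniteDimensional ℂ N) :
    ∃ E : N →L[ℂ] N, IsStarProjection E ∧ hdim E.range = ⊤ ∧ hdim (1 - E).range = ⊤ := by
  obtain ⟨b⟩ := nonempty_hilbertBasis_nat h
  have hb := b.orthonormal
  -- Odd-indexed vectors span `S`. Projecting onto `Sᗮ`, which is closed, avoids taking a closure;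
  -- it contains the even-indexed vectors, and its complement contains the odd-indexed ones.
  set S := Submodule.span ℂ (Set.range fun n => b (2 * n + 1)) with hS
  have hE : IsStarProjection Sᗮ.starProjection := isStarProjection_starProjection
  refine ⟨Sᗮ.starProjection, hE, ?_, ?_⟩
  · rw [Submodule.range_starProjection]
    refine hdim_eq_top_of_linearIndependent (v := fun n => b (2 * n))
      (hb.linearIndependent.comp _ fun m n hmn => by simpa using hmn) fun n => ?_
    rw [Submodule.mem_orthogonal, hS]
    intro u hu
    induction hu using Submodule.span_induction with
    | mem x hx =>
      obtain ⟨m, rfl⟩ := hx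
      exact hb.2 (by omega)
    | zero => exact inner_zero_left _
    | add x y _ _ hx hy => rw [inner_add_left, hx, hy, add_zero]
    | smul c x _ hx => rw [inner_smul_left, hx, mul_zero]
  · rw [range_one_sub hE, Submodule.range_starProjection]
    refine hdim_eq_top_of_linearIndependent (v := fun n => b (2 * n + 1))
      (hb.linearIndependent.comp _ fun m n hmn => by simpa using hmn) fun n => ?_
    exact Submodule.le_orthogonal_orthogonal S (Submodule.subset_span ⟨n, rfl⟩)

end Separable

section Rank

variable {H : Type*} [NormedAddCommGroup H] [InnerProductSpace ℂ H] {T : H →L[ℂ] H}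
  {E : nullSpace T 1 →L[ℂ] nullSpace T 1}

theorem hdim_range_le (E : nullSpace T 1 →L[ℂ] nullSpace T 1) :
    hdim E.range ≤ hdim (nullSpace T 1) :=
  Cardinal.toENat.monotone' (Submodule.rank_le _)

theorem hdim_range_one_sub_eq_top (h : hdim (nullSpace T 1) = ⊤) (hE : hdim E.range ≠ ⊤) :
    hdim (1 - E).range = ⊤ := by
  rw [Ne, hdim_eq_top_iff, not_not] at hE
  rw [hdim_eq_top_iff] at h ⊢
  exact fun h' => h (finiteDimensional_of_range hE h')

end Rank

/-! ### Identification of the connected components -/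

variable {H : Type*} [NormedAddCommGroup H] [InnerProductSpace ℂ H] [CompleteSpace H]
  {T : H →L[ℂ] H} {K : Type*} [NormedAddCommGroup K] [InnerProductSpace ℂ K] [CompleteSpace K]
  (W : WithLp 2 (K × K) ≃ₗᵢ[ℂ] genericSpace T) {B : K →L[ℂ] K}
  {E F : nullSpace T 1 →L[ℂ] nullSpace T 1}

theorem mem_repPairs {p : (nullSpace T 1 →L[ℂ] nullSpace T 1) → Prop} (hE : IsStarProjection E)
    (h : p E) : (repP W B E 1, repQ W B E 1) ∈ repPairs W B p :=
  ⟨E, 1, hE, h, one_mem _, Commute.one_left B, rfl⟩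

theorem apply_compress_of_mem_repPairs (hT : IsSelfAdjoint T)
    {p : (nullSpace T 1 →L[ℂ] nullSpace T 1) → Prop} {x : (H →L[ℂ] H) × (H →L[ℂ] H)}
    (hx : x ∈ repPairs W B p) :
    IsStarProjection (compress (nullSpace T 1) x.1) ∧ p (compress (nullSpace T 1) x.1) := by
  obtain ⟨E, U, hE, hp, -, -, rfl⟩ := hx
  rw [compress_repP W hT]
  exact ⟨hE, hp⟩

theorem repPairs_mono {p q : (nullSpace T 1 →L[ℂ] nullSpace T 1) → Prop}
    (h : ∀ E, IsStarProjection E → p E → q E) : repPairs W B p ⊆ repPairs W B q := by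
  rintro _ ⟨E, U, hE, hp, hU, hUB, rfl⟩
  exact ⟨E, U, hE, h E hE hp, hU, hUB, rfl⟩

theorem repPairs_congr {p q : (nullSpace T 1 →L[ℂ] nullSpace T 1) → Prop}
    (h : ∀ E, IsStarProjection E → (p E ↔ q E)) : repPairs W B p = repPairs W B q :=
  (repPairs_mono W fun E hE => (h E hE).1).antisymm (repPairs_mono W fun E hE => (h E hE).2)

theorem disjoint_repPairs (hT : IsSelfAdjoint T)
    {p q : (nullSpace T 1 →L[ℂ] nullSpace T 1) → Prop} (h : ∀ E, p E → ¬ q E) :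
    Disjoint (repPairs W B p) (repPairs W B q) :=
  Set.disjoint_left.2 fun _ hp hq => h _ (apply_compress_of_mem_repPairs W hT hp).2
    (apply_compress_of_mem_repPairs W hT hq).2

theorem classOf_eq_iff (hT : IsSelfAdjoint T) (hE : IsStarProjection E) :
    classOf W B E = classOf W B F ↔ UnitarilyEquiv E F := by
  constructor
  · intro h
    have h1 : (repP W B E 1, repQ W B E 1) ∈ classOf W B F :=
      h ▸ mem_repPairs W hE (UnitarilyEquiv.refl E)
    have h2 := (apply_compress_of_mem_repPairs W hT h1).2
    rw [compress_repP W hT] at h2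
    exact h2.symm
  · intro h
    exact repPairs_congr W fun G _ => ⟨fun h' => h.symm.trans h', fun h' => h.trans h'⟩

theorem isPreconnected_classOf (hB : IsSelfAdjoint B) (hE : IsStarProjection E) :
    IsPreconnected (classOf W B E) := by
  have h := ((isPreconnected_unitarilyEquiv E).prod (isPreconnected_unitary_commutant hB)).image
    (fun x => (repP W B x.1 x.2, repQ W B x.1 x.2))
    (continuous_repP_repQ W continuous_fst continuous_snd).continuousOn
  convert! h using 1
  ext x
  constructor
  · rintro ⟨F, U, -, hF, hU, hUB, rfl⟩
    exact ⟨(F, U), ⟨hF, hU, hUB⟩, rfl⟩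
  · rintro ⟨⟨F, U⟩, ⟨hF, hU, hUB⟩, rfl⟩
    exact ⟨F, U, UnitarilyEquiv.isStarProjection hF hE, hF, hU, hUB, rfl⟩

theorem connectedComponentIn_pairs_eq (hT : IsSelfAdjoint T) (h0 : StrictLess 0 B)
    (h1 : StrictLess B 1) (hW : genericPart T - 1 = transport W (block B 0 0 (-B)))
    {x : (H →L[ℂ] H) × (H →L[ℂ] H)} (hx : x ∈ pairs T) :
    connectedComponentIn (pairs T) x = classOf W B (compress (nullSpace T 1) x.1) := by
  have hpairs := pairs_eq_repPairs W hT h0 h1 hW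
  have hproj : ∀ y ∈ pairs T, IsStarProjection (compress (nullSpace T 1) y.1) := fun y hy =>
    (apply_compress_of_mem_repPairs W hT (hpairs ▸ hy)).1
  have hsub : classOf W B (compress (nullSpace T 1) x.1) ⊆ pairs T := by
    rw [hpairs]; exact repPairs_mono W fun _ _ _ => trivial
  have hxmem : x ∈ classOf W B (compress (nullSpace T 1) x.1) := by
    rw [hpairs] at hx
    obtain ⟨E, U, hE, -, hU, hUB, rfl⟩ := hx
    rw [compress_repP W hT]
    exact ⟨E, U, hE, UnitarilyEquiv.refl E, hU, hUB, rfl⟩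
  refine Set.Subset.antisymm ?_ ((isPreconnected_classOf W h0.nonneg.isSelfAdjoint
    (hproj x hx)).subset_connectedComponentIn hxmem hsub)
  intro y hy
  have hCsub := connectedComponentIn_subset (pairs T) x
  -- Unitary equivalence of compressions is an equivalence relation that holds locally, so it holds
  -- throughout a preconnected set.
  have hequiv : UnitarilyEquiv (compress (nullSpace T 1) x.1) (compress (nullSpace T 1) y.1) := by
    refine isPreconnected_connectedComponentIn.induction₂ (s := connectedComponentIn (pairs T) x)
      (fun y z => UnitarilyEquiv (compress (nullSpace T 1) y.1) (compress (nullSpace T 1) z.1))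
      ?_ ?_ ?_ (mem_connectedComponentIn hx) hy
    · intro y hy
      have hc : Continuous fun z : (H →L[ℂ] H) × (H →L[ℂ] H) => compress (nullSpace T 1) z.1 :=
        (continuous_compress _).comp continuous_fst
      have hev := (hc.tendsto y).eventually
        (eventually_unitarilyEquiv (hproj y (hCsub hy)))
      filter_upwards [mem_nhdsWithin_of_mem_nhds hev, self_mem_nhdsWithin] with z hz hzC
      exact hz (hproj z (hCsub hzC))
    · exact fun _ _ _ _ _ _ => UnitarilyEquiv.trans
    · exact fun _ _ _ _ => UnitarilyEquiv.symm
  have hy' := hCsub hy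
  rw [hpairs] at hy'
  obtain ⟨E, U, hE, -, hU, hUB, rfl⟩ := hy'
  rw [compress_repP W hT] at hequiv
  exact ⟨E, U, hE, hequiv, hU, hUB, rfl⟩

theorem components_pairs_eq (hT : IsSelfAdjoint T) (h0 : StrictLess 0 B)
    (h1 : StrictLess B 1) (hW : genericPart T - 1 = transport W (block B 0 0 (-B))) :
    components (pairs T) = {C | ∃ E : nullSpace T 1 →L[ℂ] nullSpace T 1,
      IsStarProjection E ∧ C = classOf W B E} := by
  have hpairs := pairs_eq_repPairs W hT h0 h1 hW
  ext C
  constructor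
  · rintro ⟨x, hx, rfl⟩
    exact ⟨_, (apply_compress_of_mem_repPairs W hT (hpairs ▸ hx)).1,
      connectedComponentIn_pairs_eq W hT h0 h1 hW hx⟩
  · rintro ⟨E, hE, rfl⟩
    have hx : (repP W B E 1, repQ W B E 1) ∈ pairs T := hpairs ▸ mem_repPairs W hE trivial
    refine ⟨_, hx, ?_⟩
    rw [connectedComponentIn_pairs_eq W hT h0 h1 hW hx, compress_repP W hT]

theorem classOf_eq_rankClass (hE : IsStarProjection E) {k : ℕ} (h : hdim E.range = k) :
    classOf W B E = rankClass W B k :=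
  repPairs_congr W fun _ hF => ⟨fun h' => h'.hdim_range_eq.symm.trans h,
    fun h' => unitarilyEquiv_of_hdim_range_eq hE hF h h'⟩

theorem classOf_eq_corankClass (hE : IsStarProjection E) {k : ℕ} (h : hdim (1 - E).range = k) :
    classOf W B E = corankClass W B k :=
  repPairs_congr W fun _ hF => ⟨fun h' => h'.one_sub.hdim_range_eq.symm.trans h,
    fun h' => unitarilyEquiv_of_hdim_range_one_sub_eq hE hF h h'⟩

theorem classOf_eq_infiniteClass [TopologicalSpace.SeparableSpace (nullSpace T 1)]
    (hE : IsStarProjection E) (h : hdim E.range = ⊤) (h' : hdim (1 - E).range = ⊤) :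
    classOf W B E = infiniteClass W B :=
  repPairs_congr W fun _ hF => ⟨fun e => ⟨e.hdim_range_eq.symm.trans h,
      e.one_sub.hdim_range_eq.symm.trans h'⟩,
    fun e => unitarilyEquiv_of_separableSpace hE hF h h' e.1 e.2⟩

/-- The bound on `k` makes the class nonempty; beyond the dimension of `N(T - I)` all rank classes
are empty and coincide. -/
theorem eq_of_rankClass_eq (hT : IsSelfAdjoint T) {k l : ℕ}
    (hk : (k : ℕ∞) ≤ hdim (nullSpace T 1)) (h : rankClass W B k = rankClass W B l) : k = l := by
  obtain ⟨E, hE, hEk⟩ := exists_isStarProjection_hdim_range_eq hk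
  have h2 : (repP W B E 1, repQ W B E 1) ∈ rankClass W B l := h ▸ mem_repPairs W hE hEk
  have h3 := (apply_compress_of_mem_repPairs W hT h2).2
  rw [compress_repP W hT, hEk] at h3
  exact_mod_cast h3

theorem exists_isStarProjection_hdim_range_one_sub_eq {k : ℕ}
    (hk : (k : ℕ∞) ≤ hdim (nullSpace T 1)) :
    ∃ E : nullSpace T 1 →L[ℂ] nullSpace T 1, IsStarProjection E ∧ hdim (1 - E).range = k := by
  obtain ⟨E, hE, hEk⟩ := exists_isStarProjection_hdim_range_eq hk
  exact ⟨1 - E, IsStarProjection.one_sub (R := nullSpace T 1 →L[ℂ] nullSpace T 1) hE,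
    by rwa [sub_sub_cancel]⟩

theorem eq_of_corankClass_eq (hT : IsSelfAdjoint T) {k l : ℕ}
    (hk : (k : ℕ∞) ≤ hdim (nullSpace T 1)) (h : corankClass W B k = corankClass W B l) :
    k = l := by
  obtain ⟨E, hE, hEk⟩ := exists_isStarProjection_hdim_range_one_sub_eq hk
  have h2 : (repP W B E 1, repQ W B E 1) ∈ corankClass W B l := h ▸ mem_repPairs W hE hEk
  have h3 := (apply_compress_of_mem_repPairs W hT h2).2
  rw [compress_repP W hT, hEk] at h3
  exact_mod_cast h3

theorem components_pairs_eq_of_infinite (hT : IsSelfAdjoint T) (h0 : StrictLess 0 B)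
    (h1 : StrictLess B 1) (hW : genericPart T - 1 = transport W (block B 0 0 (-B)))
    (h : hdim (nullSpace T 1) = ⊤) :
    components (pairs T) = Set.range (rankClass W B) ∪ Set.range (corankClass W B) ∪
      {C | ∃ E : nullSpace T 1 →L[ℂ] nullSpace T 1, IsStarProjection E ∧ hdim E.range = ⊤ ∧
        hdim (1 - E).range = ⊤ ∧ C = classOf W B E} := by
  rw [components_pairs_eq W hT h0 h1 hW]
  ext C
  constructor
  · rintro ⟨E, hE, rfl⟩
    by_cases hr : hdim E.range = ⊤
    · by_cases hc : hdim (1 - E).range = ⊤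
      · exact Or.inr ⟨E, hE, hr, hc, rfl⟩
      · obtain ⟨n, hn⟩ := ENat.ne_top_iff_exists.1 hc
        exact Or.inl (Or.inr ⟨n, (classOf_eq_corankClass W hE hn.symm).symm⟩)
    · obtain ⟨n, hn⟩ := ENat.ne_top_iff_exists.1 hr
      exact Or.inl (Or.inl ⟨n, (classOf_eq_rankClass W hE hn.symm).symm⟩)
  · rintro ((⟨n, rfl⟩ | ⟨n, rfl⟩) | ⟨E, hE, -, -, rfl⟩)
    · obtain ⟨E, hE, hn⟩ := exists_isStarProjection_hdim_range_eq (N := nullSpace T 1) (k := n)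
        (le_top.trans_eq h.symm)
      exact ⟨E, hE, (classOf_eq_rankClass W hE hn).symm⟩
    · obtain ⟨E, hE, hn⟩ := exists_isStarProjection_hdim_range_one_sub_eq (T := T) (k := n)
        (le_top.trans_eq h.symm)
      exact ⟨E, hE, (classOf_eq_corankClass W hE hn).symm⟩
    · exact ⟨E, hE, rfl⟩

theorem components_pairs_eq_of_separableSpace (hT : IsSelfAdjoint T) (h0 : StrictLess 0 B)
    (h1 : StrictLess B 1) (hW : genericPart T - 1 = transport W (block B 0 0 (-B)))
    (h : hdim (nullSpace T 1) = ⊤) [TopologicalSpace.SeparableSpace (nullSpace T 1)] :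
    components (pairs T) = Set.range (rankClass W B) ∪ Set.range (corankClass W B) ∪
      {infiniteClass W B} := by
  rw [components_pairs_eq_of_infinite W hT h0 h1 hW h]
  congr 1
  ext C
  constructor
  · rintro ⟨E, hE, hr, hc, rfl⟩
    exact classOf_eq_infiniteClass W hE hr hc
  · rintro rfl
    obtain ⟨E, hE, hr, hc⟩ := exists_isStarProjection_hdim_range_eq_top
      (hdim_eq_top_iff.1 h)
    exact ⟨E, hE, hr, hc, (classOf_eq_infiniteClass W hE hr hc).symm⟩

end PencilPairs

end

theorem corollary2p10
    {H : Type*} [NormedAddCommGroup H] [InnerProductSpace ℂ H] [CompleteSpace H]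
    (T : H →L[ℂ] H) (hT : IsSelfAdjoint T)
    {K : Type*} [NormedAddCommGroup K] [InnerProductSpace ℂ K] [CompleteSpace K]
    (B : K →L[ℂ] K) (hB0 : PencilPairs.StrictLess 0 B) (hB1 : PencilPairs.StrictLess B 1)
    (W : WithLp 2 (K × K) ≃ₗᵢ[ℂ] PencilPairs.genericSpace T)
    (hW : PencilPairs.genericPart T - 1 =
      PencilPairs.transport W (PencilPairs.block B 0 0 (-B))) :
    -- the components are indexed by the unitary equivalence class of `E`
    (PencilPairs.components (PencilPairs.pairs T) =
        {C | ∃ E : PencilPairs.nullSpace T 1 →L[ℂ] PencilPairs.nullSpace T 1,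
          IsStarProjection E ∧ C = PencilPairs.classOf W B E} ∧
      ∀ E E' : PencilPairs.nullSpace T 1 →L[ℂ] PencilPairs.nullSpace T 1,
        IsStarProjection E → IsStarProjection E' →
          (PencilPairs.classOf W B E = PencilPairs.classOf W B E' ↔
            PencilPairs.UnitarilyEquiv E E')) ∧
    -- finite-dimensional `N(T - I)`
    (PencilPairs.hdim (PencilPairs.nullSpace T 1) < ⊤ →
      PencilPairs.components (PencilPairs.pairs T) =
        {C | ∃ k : ℕ, (k : ℕ∞) ≤ PencilPairs.hdim (PencilPairs.nullSpace T 1) ∧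
          C = PencilPairs.rankClass W B k} ∧
      ∀ k l : ℕ, (k : ℕ∞) ≤ PencilPairs.hdim (PencilPairs.nullSpace T 1) →
        (l : ℕ∞) ≤ PencilPairs.hdim (PencilPairs.nullSpace T 1) →
          PencilPairs.rankClass W B k = PencilPairs.rankClass W B l → k = l) ∧
    -- infinite-dimensional `N(T - I)`
    (PencilPairs.hdim (PencilPairs.nullSpace T 1) = ⊤ →
      PencilPairs.components (PencilPairs.pairs T) =
        Set.range (PencilPairs.rankClass W B) ∪ Set.range (PencilPairs.corankClass W B) ∪
          {C | ∃ E : PencilPairs.nullSpace T 1 →L[ℂ] PencilPairs.nullSpace T 1,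
            IsStarProjection E ∧ PencilPairs.hdim E.range = ⊤ ∧
              PencilPairs.hdim (1 - E).range = ⊤ ∧ C = PencilPairs.classOf W B E} ∧
      Function.Injective (PencilPairs.rankClass W B) ∧
      Function.Injective (PencilPairs.corankClass W B) ∧
      (∀ m n : ℕ, PencilPairs.rankClass W B m ≠ PencilPairs.corankClass W B n) ∧
      (∀ m : ℕ, Disjoint (PencilPairs.rankClass W B m) (PencilPairs.infiniteClass W B)) ∧
      (∀ n : ℕ, Disjoint (PencilPairs.corankClass W B n) (PencilPairs.infiniteClass W B)) ∧
      -- all infinite dimensions in `N(T - I)` coincide: a single class with both infinite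
      (TopologicalSpace.SeparableSpace (PencilPairs.nullSpace T 1) →
        PencilPairs.components (PencilPairs.pairs T) =
          Set.range (PencilPairs.rankClass W B) ∪ Set.range (PencilPairs.corankClass W B) ∪
            {PencilPairs.infiniteClass W B})) := by
  open PencilPairs in
  refine ⟨⟨components_pairs_eq W hT hB0 hB1 hW, fun E E' hE _ => classOf_eq_iff W hT hE⟩,
    fun hfin => ⟨?_, fun k l hk _ h => eq_of_rankClass_eq W hT hk h⟩, fun hinf =>
    ⟨components_pairs_eq_of_infinite W hT hB0 hB1 hW hinf,
      fun k l h => eq_of_rankClass_eq W hT (le_top.trans_eq hinf.symm) h,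
      fun k l h => eq_of_corankClass_eq W hT (le_top.trans_eq hinf.symm) h,
      fun m n h => ?_,
      fun m => disjoint_repPairs W hT fun E h h' => ENat.natCast_ne_top m (h.symm.trans h'.1),
      fun n => disjoint_repPairs W hT fun E h h' => ENat.natCast_ne_top n (h.symm.trans h'.2),
      fun hsep => components_pairs_eq_of_separableSpace W hT hB0 hB1 hW hinf⟩⟩
  · rw [components_pairs_eq W hT hB0 hB1 hW]
    ext C
    constructor
    · rintro ⟨E, hE, rfl⟩
      obtain ⟨k, hk⟩ := ENat.ne_top_iff_exists.1 ((hdim_range_le E).trans_lt hfin).ne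
      exact ⟨k, hk ▸ hdim_range_le E, classOf_eq_rankClass W hE hk.symm⟩
    · rintro ⟨k, hk, rfl⟩
      obtain ⟨E, hE, hEk⟩ := exists_isStarProjection_hdim_range_eq hk
      exact ⟨E, hE, (classOf_eq_rankClass W hE hEk).symm⟩
  -- On an infinite-dimensional space a projection of finite rank `m` has infinite corank, so its
  -- pair lies in no corank class.
  · obtain ⟨E, hE, hEm⟩ := exists_isStarProjection_hdim_range_eq (N := nullSpace T 1) (k := m)
      (le_top.trans_eq hinf.symm)
    have h2 : (repP W B E 1, repQ W B E 1) ∈ corankClass W B n := h ▸ mem_repPairs W hE hEm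
    have h3 := (apply_compress_of_mem_repPairs W hT h2).2
    rw [compress_repP W hT,
      hdim_range_one_sub_eq_top hinf (hEm ▸ ENat.natCast_ne_top m)] at h3
    exact ENat.natCast_ne_top n h3.symm
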